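/- Let $d\ge 1$, let $\mathbb T^d=\mathbb R^d/\mathbb Z^d$ with its normalized Lebesgue measure $\mu$ and its Euclidean (quotient) distance, and for $\Omega\subseteq\mathbb T^d$ let $\operatorname{dist}(x,\partial\Omega)$ be the distance of $x$ from the boundary of $\Omega$ ($=\infty$ if $\partial\Omega=\emptyset$). Fix a smooth, real-valued, radial function $\varphi$ on $\mathbb R^d$ with $\varphi(\xi)=0$ for $|\xi|\ge 1/2$ and $\int\varphi^2=1$, and put $$K(x)=\int_{\mathbb R^d}(1+|\xi|^2)^{-(d+1)/2}\,(\varphi*\varphi)(\xi)\,e^{2\pi i\xi\cdot x}\,d\xi,\qquad \psi(t)=4e^{2\pi}\Big(\int_{|y|\le1}K(y)\,dy\Big)^{-1}\int_{|y|\ge t/2}K(y)\,dy\quad(t\ge 0),\qquad \psi(\infty)=0.$$ For $0\le\alpha\le (d+1)/2$, $0\le\beta\le1$ and a measurable set $\Omega\subseteq\mathbb T^d$ let $F(\alpha,\beta,\Omega)\in[0,\infty]$ be the smallest constant $C$ such that $$\Big|\int_{\mathbb T^d}\chi_\Omega(x)e^{-2\pi ik\cdot x}dx\Big|\le C|k|^{-\alpha}\quad(k\in\mathbb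 Z^d\setminus\{0\}),$$ and, for every $R>0$, $$\Big|\int_{\mathbb T^d}\psi\big(R\operatorname{dist}(x,\partial\Omega)\big)e^{-2\pi ik\cdot x}dx\Big|\le\begin{cases}C|k|^{-\alpha}&\text{if }0<|k|<R,\\ CR^{-\beta}&\text{if }k=0.\end{cases}$$ For $0\le\alpha\le1$ let $M(\alpha,\Omega)=\sup_{t>0}t^{-\alpha}\mu(\{x:\operatorname{dist}(x,\partial\Omega)<t\})\in[0,\infty]$. Let $\varepsilon>0$. (a) For almost every $x\in\mathbb T^d$ the following holds. For every $\eta>0$ there is a constant $c>0$ such that for all $\alpha,\beta$ with $0\le\alpha\le(d+1)/2$, $0\le\beta\le1$ and $d+\beta-\alpha\ge\eta$, all integers $m>1$ and all measurable $\Omega\subseteq\mathbb T^d$, $$\Big|\mu(\Omega)-m^{-1}\sum_{j=1}^m\chi_\Omega(jx)\Big|\le c\,F(\alpha,\beta,\Omega)\,m^{-\beta/(d+\beta-\alpha)}\log^{\beta(d+1+\varepsilon)/(d+\beta-\alpha)}(m).$$ (If $d\ge2$, then always $d+\beta-\alpha\ge1/2$, so that $c$ can be chosen independently of $\alpha,\beta$.)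 (b) For almost every $x\in\mathbb T^d$ there is a constant $c>0$ such that for all $0\le\alpha\le1$, all $\gamma>0$, all integers $m>1$ and all measurable $\Omega\subseteq\mathbb T^d$ with $M(\alpha,\Omega)<\gamma$, $$\Big|\mu(\Omega)-m^{-1}\sum_{j=1}^m\chi_\Omega(jx)\Big|\le c\,\gamma\,m^{-\alpha/d}\log^{\alpha(d+1+\varepsilon)/d}(m).$$ -/

import Mathlib

open MeasureTheory Set
open scoped ENNReal ContDiff FourierTransform Convolution

namespace ErdosTuran

noncomputable section

/-- The functions `φ` admitted in the construction of the kernel: smooth, real valued, radial,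
vanishing for `|ξ| ≥ 1/2`, with `∫ φ² = 1`. -/
structure IsProfile {d : ℕ} (φ : EuclideanSpace ℝ (Fin d) → ℝ) : Prop where
  smooth : ContDiff ℝ ∞ φ
  radial : ∀ ξ η, ‖ξ‖ = ‖η‖ → φ ξ = φ η
  support : ∀ ξ, 1 / 2 ≤ ‖ξ‖ → φ ξ = 0
  norm_sq : ∫ ξ, φ ξ ^ 2 = 1

/-- The Fourier transform `(1 + |ξ|²) ^ (-(d+1)/2) · (φ ∗ φ)(ξ)` of the kernel. -/
def kernelHat {d : ℕ} (φ : EuclideanSpace ℝ (Fin d) → ℝ) (ξ : EuclideanSpace ℝ (Fin d)) : ℝ :=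
  (1 + ‖ξ‖ ^ 2) ^ (-((d : ℝ) + 1) / 2) *
    (φ ⋆[ContinuousLinearMap.mul ℝ ℝ, volume] φ) ξ

/-- The kernel `K(x) = ∫ (1 + |ξ|²) ^ (-(d+1)/2) (φ ∗ φ)(ξ) exp (2πi ξ·x) dξ`; the integral is
real because its density `kernelHat φ` is real and even, so taking the real part only changes
the type. -/
def kernel {d : ℕ} (φ : EuclideanSpace ℝ (Fin d) → ℝ) (x : EuclideanSpace ℝ (Fin d)) : ℝ :=
  (𝓕⁻ (fun ξ => (kernelHat φ ξ : ℂ)) x).re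

/-- `I(t) = ∫_{|x| ≥ t} K(x) dx` for `0 ≤ t ≤ ∞`; in particular `I(∞) = 0`. -/
def kernelTail {d : ℕ} (φ : EuclideanSpace ℝ (Fin d) → ℝ) (t : ℝ≥0∞) : ℝ :=
  ∫ x in {x : EuclideanSpace ℝ (Fin d) | t ≤ ENNReal.ofReal ‖x‖}, kernel φ x

/-- The rapidly decreasing function `ψ(t) = 4 exp(2π) (∫_{|y| ≤ 1} K(y) dy)⁻¹ I(t/2)` for
`0 ≤ t ≤ ∞`; in particular `ψ(∞) = 0`. -/
def psi {d : ℕ} (φ : EuclideanSpace ℝ (Fin d) → ℝ) (t : ℝ≥0∞) : ℝ :=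
  4 * (Real.exp (2 * Real.pi) *
    (∫ y in Metric.closedBall (0 : EuclideanSpace ℝ (Fin d)) 1, kernel φ y)⁻¹) *
    kernelTail φ (t / 2)

/-- The Euclidean (quotient) distance on the torus `ℝᵈ/ℤᵈ`; the norm on `ℝ/ℤ` is the distance
to the nearest integer. -/
def torusDist {d : ℕ} (x y : UnitAddTorus (Fin d)) : ℝ :=
  √(∑ i, ‖x i - y i‖ ^ 2)

/-- `dist(x, ∂Ω)` on the torus; it is `∞` if `∂Ω` is empty. -/
def boundaryDist {d : ℕ} (Ω : Set (UnitAddTorus (Fin d))) (x : UnitAddTorus (Fin d)) : ℝ≥0∞ :=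
  ⨅ y ∈ frontier Ω, ENNReal.ofReal (torusDist x y)

/-- The Euclidean norm of a frequency `k ∈ ℤᵈ`. -/
def freqNorm {d : ℕ} (k : Fin d → ℤ) : ℝ :=
  √(∑ i, (k i : ℝ) ^ 2)

/-- The Fourier coefficient `∫ f(x) exp (-2πi k·x) dx` of a real function on the torus. -/
def torusCoeff {d : ℕ} (f : UnitAddTorus (Fin d) → ℝ) (k : Fin d → ℤ) : ℂ :=
  ∫ x, (f x : ℂ) * UnitAddTorus.mFourier (-k) x

/-- `c` is a constant for which the estimates defining the class of sets with parameters
`α`, `β` hold for `Ω`. -/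
structure IsFourierBound {d : ℕ} (φ : EuclideanSpace ℝ (Fin d) → ℝ) (α β : ℝ)
    (Ω : Set (UnitAddTorus (Fin d))) (c : ℝ≥0∞) : Prop where
  indicator_le : ∀ k : Fin d → ℤ, k ≠ 0 →
    ‖torusCoeff (Ω.indicator fun _ => 1) k‖ₑ ≤ c * ENNReal.ofReal (freqNorm k ^ (-α))
  boundary_le : ∀ R : ℝ, 0 < R → ∀ k : Fin d → ℤ, k ≠ 0 → freqNorm k < R →
    ‖torusCoeff (fun x => psi φ (ENNReal.ofReal R * boundaryDist Ω x)) k‖ₑ ≤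
      c * ENNReal.ofReal (freqNorm k ^ (-α))
  boundary_zero_le : ∀ R : ℝ, 0 < R →
    ‖torusCoeff (fun x => psi φ (ENNReal.ofReal R * boundaryDist Ω x)) 0‖ₑ ≤
      c * ENNReal.ofReal (R ^ (-β))

/-- `F(α, β, Ω)`: the smallest admissible constant, `∞` if there is no finite one. -/
def fourierConst {d : ℕ} (φ : EuclideanSpace ℝ (Fin d) → ℝ) (α β : ℝ)
    (Ω : Set (UnitAddTorus (Fin d))) : ℝ≥0∞ :=
  sInf {c | IsFourierBound φ α β Ω c}

/-- `M(α, Ω) = sup_{t > 0} t ^ (-α) μ {x | dist(x, ∂Ω) < t}`. -/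
def minkowskiConst {d : ℕ} (α : ℝ) (Ω : Set (UnitAddTorus (Fin d))) : ℝ≥0∞ :=
  ⨆ (t : ℝ) (_ : 0 < t),
    ENNReal.ofReal (t ^ (-α)) * volume {x | boundaryDist Ω x < ENNReal.ofReal t}

/-- The discrepancy `|μ(Ω) - m⁻¹ ∑_{j=1}^m χ_Ω(jx)|` of the arithmetic progression
`x, 2x, …, mx`. -/
def discrepancy {d : ℕ} (x : UnitAddTorus (Fin d)) (m : ℕ)
    (Ω : Set (UnitAddTorus (Fin d))) : ℝ :=
  |volume.real Ω - (m : ℝ)⁻¹ * ∑ j ∈ Finset.Icc 1 m, Ω.indicator (fun _ => (1 : ℝ)) (j • x)|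

end

end ErdosTuran

open ErdosTuran

namespace ErdosTuran

/-! ### The Gaussian subordination of the exponential -/

/-! The proof joins an Erdős–Turán inequality with a metric estimate for small divisors.

Up to a positive constant, `kernel φ` is the convolution of exp(-2π|x|) with the square of the
inverse Fourier transform of φ (`fourierInv_kernelHat`). Hence it is nonnegative, has mass one,
changes by a factor of at most exp(2π|z|) under translation by z (`kernel_add_le`), and has its
spectrum in the unit ball. Convolution at scale 1/R turns any bounded measurable function on the
torus into a trigonometric polynomial with frequencies below R (`smoothing_eq_sum`). A translation
shorter than dist(x, ∂Ω) does not change membership in Ω, so the indicator differs from its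
smoothing by at most the kernel tail beyond R dist(x, ∂Ω). By the slow variation, that tail is at
most the smoothing of ψ(R dist(·, ∂Ω)), again a trigonometric polynomial
(`kernelTail_le_smoothing`). Averaging both polynomials along x, 2x, …, mx gives `discrepancy_le`.

The exponential sums are O(1/(m‖k·x‖)). Truncated at a power of the size of k, the function 1/‖k·x‖
has integral of logarithmic order, and Borel–Cantelli disposes of the truncated part. So for almost
every x the sum of 1/‖k·x‖ against ∏ 1/(|kᵢ| log^{1+δ}) · 1/log converges
(`ae_summable_freqWeight_mul_inv`). With dδ = ε this costs d(1+δ)+1 = d+1+ε logarithms, whence a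
bound m⁻¹ R^{d-α} log^{d+1+ε} for the weighted exponential sums. The choice R^{d+β-α} =
m/log^{d+1+ε} m balances it against R^{-β}.

For (b), a Minkowski bound on the boundary yields the Fourier bounds with β = α: a half-period
translation handles the indicator, and an integral over the boundary layer handles ψ
(`isFourierBound_of_minkowskiConst_le`). -/

lemma hasDerivAt_sub_div (a : ℝ) {s : ℝ} (hs : s ≠ 0) :
    HasDerivAt (fun s : ℝ => s - a / s) (1 + a / s ^ 2) s := by
  have h := (hasDerivAt_id s).sub ((hasDerivAt_inv hs).const_mul a)
  refine (h.congr_deriv ?_).congr_of_eventuallyEq (Filter.Eventually.of_forall fun t => ?_)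
  · simp [div_eq_mul_inv]
  · simp [div_eq_mul_inv]

lemma strictMonoOn_sub_div {a : ℝ} (ha : 0 < a) :
    StrictMonoOn (fun s : ℝ => s - a / s) (Ioi 0) := by
  intro s hs t ht hst
  have : a / t < a / s := div_lt_div_of_pos_left ha hs hst
  simp only
  linarith

lemma image_sub_div {a : ℝ} (ha : 0 < a) :
    (fun s : ℝ => s - a / s) '' Ioi 0 = univ := by
  refine eq_univ_of_forall fun u => ?_
  have h1 : |u| < √(u ^ 2 + 4 * a) := by
    rw [← Real.sqrt_sq_eq_abs]
    exact Real.sqrt_lt_sqrt (sq_nonneg _) (by linarith)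
  have h2 : √(u ^ 2 + 4 * a) ^ 2 = u ^ 2 + 4 * a := Real.sq_sqrt (by positivity)
  -- The preimage of u is the positive root of s² - us - a = 0.
  have h3 : 0 < (u + √(u ^ 2 + 4 * a)) / 2 := by
    have := neg_abs_le u
    linarith
  refine ⟨_, h3, ?_⟩
  simp only
  rw [sub_eq_iff_eq_add, ← sub_eq_iff_eq_add', eq_div_iff h3.ne']
  nlinarith

/-- The substitution u = s - a/s carries (0, ∞) bijectively onto ℝ, and the prefactor is its
Jacobian, so only the Gaussian in u remains. The value in the next lemma comes the same way. -/
lemma integrableOn_exp_neg_sub_div_sq_mul {a : ℝ} (ha : 0 < a) :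
    IntegrableOn (fun s : ℝ => (1 + a / s ^ 2) * Real.exp (-(s - a / s) ^ 2)) (Ioi 0) := by
  have h := (integrableOn_image_iff_integrableOn_abs_deriv_smul (measurableSet_Ioi (a := (0 : ℝ)))
    (fun s hs => (hasDerivAt_sub_div a (ne_of_gt hs)).hasDerivWithinAt)
    (strictMonoOn_sub_div ha).injOn (fun u => Real.exp (-u ^ 2))).1
    (by
      rw [image_sub_div ha, integrableOn_univ]
      simpa using integrable_exp_neg_mul_sq (b := 1) one_pos)
  refine h.congr_fun (fun s hs => ?_) measurableSet_Ioi
  simp only [smul_eq_mul]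
  rw [abs_of_pos (by positivity)]

lemma integral_exp_neg_sub_div_sq_mul {a : ℝ} (ha : 0 < a) :
    ∫ s in Ioi (0 : ℝ), (1 + a / s ^ 2) * Real.exp (-(s - a / s) ^ 2) = √Real.pi := by
  have h := integral_image_eq_integral_abs_deriv_smul (measurableSet_Ioi (a := (0 : ℝ)))
    (fun s hs => (hasDerivAt_sub_div a (ne_of_gt hs)).hasDerivWithinAt)
    (strictMonoOn_sub_div ha).injOn (fun u => Real.exp (-u ^ 2))
  rw [image_sub_div ha, setIntegral_univ] at h
  have h2 := integral_gaussian 1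
  simp only [neg_mul, one_mul, div_one] at h2
  rw [← h2, h]
  refine setIntegral_congr_fun measurableSet_Ioi fun s hs => ?_
  simp only [smul_eq_mul]
  rw [abs_of_pos (by positivity)]

/-- The inversion s ↦ a/s has Jacobian a/s² and merely flips the sign of s - a/s. So both terms of
the weight 1 + a/s² contribute equally, and dropping one halves the integral. -/
lemma integral_exp_neg_sub_div_sq_inversion {a : ℝ} (ha : 0 < a) :
    ∫ s in Ioi (0 : ℝ), a / s ^ 2 * Real.exp (-(s - a / s) ^ 2) =
      ∫ s in Ioi (0 : ℝ), Real.exp (-(s - a / s) ^ 2) := by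
  have himg : (fun s : ℝ => a / s) '' Ioi 0 = Ioi 0 := by
    ext t
    constructor
    · rintro ⟨s, hs, rfl⟩
      exact div_pos ha hs
    · intro ht
      exact ⟨a / t, div_pos ha ht, by field_simp⟩
  have hinj : InjOn (fun s : ℝ => a / s) (Ioi 0) := by
    intro s hs t ht h
    simpa [div_eq_mul_inv, ha.ne'] using h
  have h := integral_image_eq_integral_abs_deriv_smul (measurableSet_Ioi (a := (0 : ℝ)))
    (f := fun s : ℝ => a / s) (f' := fun s => a * -(s ^ 2)⁻¹)
    (fun s hs => by
      simpa only [div_eq_mul_inv] using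
        ((hasDerivAt_inv (ne_of_gt hs)).const_mul a).hasDerivWithinAt)
    hinj (fun u => Real.exp (-(u - a / u) ^ 2))
  rw [himg] at h
  rw [h]
  refine setIntegral_congr_fun measurableSet_Ioi fun s hs => ?_
  have hs' : (0 : ℝ) < s := hs
  simp only [smul_eq_mul]
  have h1 : |a * -(s ^ 2)⁻¹| = a / s ^ 2 := by
    rw [mul_neg, abs_neg, abs_of_pos (by positivity), div_eq_mul_inv]
  have h2 : a / s - a / (a / s) = -(s - a / s) := by
    rw [div_div_cancel₀ ha.ne']; ring
  rw [h1, h2, neg_sq]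

lemma integrableOn_exp_neg_sub_div_sq {a : ℝ} (ha : 0 < a) :
    IntegrableOn (fun s : ℝ => Real.exp (-(s - a / s) ^ 2)) (Ioi 0) := by
  refine (integrableOn_exp_neg_sub_div_sq_mul ha).mono' (by fun_prop) ?_
  refine Filter.Eventually.of_forall fun s => ?_
  rw [Real.norm_of_nonneg (Real.exp_pos _).le]
  exact le_mul_of_one_le_left (Real.exp_pos _).le (le_add_of_nonneg_right (by positivity))

/-- The Cauchy–Schlömilch integral. -/
lemma integral_exp_neg_sub_div_sq {a : ℝ} (ha : 0 < a) :
    ∫ s in Ioi (0 : ℝ), Real.exp (-(s - a / s) ^ 2) = √Real.pi / 2 := by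
  have h := integral_exp_neg_sub_div_sq_mul ha
  have hi := integrableOn_exp_neg_sub_div_sq ha
  have hi2 : IntegrableOn (fun s : ℝ => a / s ^ 2 * Real.exp (-(s - a / s) ^ 2)) (Ioi 0) := by
    refine ((integrableOn_exp_neg_sub_div_sq_mul ha).sub hi).congr_fun (fun s _ => ?_)
      measurableSet_Ioi
    simp only [Pi.sub_apply]
    ring
  have h2 : ∫ s in Ioi (0 : ℝ), (1 + a / s ^ 2) * Real.exp (-(s - a / s) ^ 2) =
      (∫ s in Ioi (0 : ℝ), Real.exp (-(s - a / s) ^ 2)) +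
        ∫ s in Ioi (0 : ℝ), a / s ^ 2 * Real.exp (-(s - a / s) ^ 2) := by
    rw [← integral_add hi hi2]
    simp only [add_mul, one_mul]
  rw [h, integral_exp_neg_sub_div_sq_inversion ha] at h2
  linarith

lemma integral_exp_neg_sq_sub_div_sq {a : ℝ} (ha : 0 ≤ a) :
    ∫ s in Ioi (0 : ℝ), Real.exp (-s ^ 2 - a ^ 2 / s ^ 2) =
      √Real.pi / 2 * Real.exp (-2 * a) := by
  rcases ha.eq_or_lt with rfl | ha
  · have h0 : ∫ s in Ioi (0 : ℝ), Real.exp (-1 * s ^ 2) = √(Real.pi / 1) / 2 :=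
      integral_gaussian_Ioi 1
    simp only [neg_mul, one_mul, div_one] at h0
    norm_num
    exact h0
  · rw [← integral_exp_neg_sub_div_sq ha, ← integral_mul_const]
    refine setIntegral_congr_fun measurableSet_Ioi fun s hs => ?_
    have hs' : s ≠ 0 := ne_of_gt hs
    rw [← Real.exp_add]
    congr 1
    field_simp
    ring

/-! ### The Fourier transform of the exponential -/

section BesselPotential

variable {V : Type*} [NormedAddCommGroup V]

/-- A mixture of Gaussians, so that the Fourier transform can be computed one Gaussian at a time. -/
lemma exp_neg_two_pi_norm_eq (x : V) :
    Real.exp (-(2 * Real.pi * ‖x‖)) =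
      2 / √Real.pi * ∫ s in Ioi (0 : ℝ), Real.exp (-s ^ 2 - (Real.pi * ‖x‖) ^ 2 / s ^ 2) := by
  have h : √Real.pi ≠ 0 := (Real.sqrt_pos.2 Real.pi_pos).ne'
  rw [integral_exp_neg_sq_sub_div_sq (by positivity)]
  field_simp

/-- The joint density on scales and points whose marginal is the exponential. -/
noncomputable def subordinatedGaussian (p : ℝ × V) : ℝ :=
  Real.exp (-p.1 ^ 2) * Real.exp (-(Real.pi ^ 2 / p.1 ^ 2) * ‖p.2‖ ^ 2)

lemma subordinatedGaussian_eq (s : ℝ) (x : V) :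
    subordinatedGaussian (s, x) = Real.exp (-s ^ 2 - (Real.pi * ‖x‖) ^ 2 / s ^ 2) := by
  rw [subordinatedGaussian, ← Real.exp_add]
  congr 1
  ring

variable [InnerProductSpace ℝ V] [FiniteDimensional ℝ V] [MeasurableSpace V] [BorelSpace V]

lemma integrable_gaussian (V : Type*) [NormedAddCommGroup V] [InnerProductSpace ℝ V]
    [FiniteDimensional ℝ V] [MeasurableSpace V] [BorelSpace V] {b : ℝ} (hb : 0 < b) :
    Integrable fun x : V => Real.exp (-b * ‖x‖ ^ 2) := by
  have h := (GaussianFourier.integrable_cexp_neg_mul_sq_norm_add (V := V) (b := b)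
    (by simpa using hb) 0 0).norm
  refine h.congr (Filter.Eventually.of_forall fun x => ?_)
  simp only [zero_mul, add_zero, Complex.norm_exp]
  congr 1
  norm_cast

lemma integral_gaussian_norm {b : ℝ} (hb : 0 < b) :
    ∫ x : V, Real.exp (-b * ‖x‖ ^ 2) = (Real.pi / b) ^ (Module.finrank ℝ V / 2 : ℝ) :=
  GaussianFourier.integral_rexp_neg_mul_sq_norm hb

/-- Integrating out the point leaves a constant times sⁿ exp(-s²), with n the dimension. This
absolute integrability justifies the later interchange of integrals. -/
lemma integrable_subordinatedGaussian :
    Integrable (subordinatedGaussian (V := V)) ((volume.restrict (Ioi 0)).prod volume) := by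
  have hm : Measurable (subordinatedGaussian (V := V)) := by
    unfold subordinatedGaussian
    fun_prop
  rw [integrable_prod_iff hm.aestronglyMeasurable]
  constructor
  · filter_upwards [ae_restrict_mem measurableSet_Ioi] with s hs
    have hs' : (0 : ℝ) < s := hs
    exact (integrable_gaussian V (b := Real.pi ^ 2 / s ^ 2) (by positivity)).const_mul
      (Real.exp (-s ^ 2))
  · have h := (integrableOn_rpow_mul_exp_neg_mul_sq (b := 1) one_pos
      (s := Module.finrank ℝ V) (by linarith [(Module.finrank ℝ V).cast_nonneg (α := ℝ)])).const_mul
        (Real.pi ^ (-(Module.finrank ℝ V / 2 : ℝ)))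
    refine h.congr ?_
    filter_upwards [ae_restrict_mem measurableSet_Ioi] with s hs
    have hs' : (0 : ℝ) < s := hs
    have h1 : ∀ x : V, ‖subordinatedGaussian (s, x)‖ =
        Real.exp (-s ^ 2) * Real.exp (-(Real.pi ^ 2 / s ^ 2) * ‖x‖ ^ 2) := fun x =>
      Real.norm_of_nonneg (by unfold subordinatedGaussian; positivity)
    simp_rw [h1]
    rw [integral_const_mul, integral_gaussian_norm (by positivity)]
    have h2 : Real.pi / (Real.pi ^ 2 / s ^ 2) = Real.pi⁻¹ * s ^ 2 := by
      field_simp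
    rw [h2, Real.mul_rpow (by positivity) (by positivity), ← Real.rpow_natCast s 2,
      ← Real.rpow_mul hs'.le, Real.inv_rpow Real.pi_pos.le, ← Real.rpow_neg Real.pi_pos.le]
    rw [show ((2 : ℕ) : ℝ) * (Module.finrank ℝ V / 2 : ℝ) = Module.finrank ℝ V by
      push_cast; ring]
    simp only [Real.rpow_natCast]
    ring_nf

lemma integrable_exp_neg_two_pi_norm (V : Type*) [NormedAddCommGroup V] [InnerProductSpace ℝ V]
    [FiniteDimensional ℝ V] [MeasurableSpace V] [BorelSpace V] :
    Integrable fun x : V => Real.exp (-(2 * Real.pi * ‖x‖)) := by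
  have h := (integrable_subordinatedGaussian (V := V)).integral_prod_right.const_mul (2 / √Real.pi)
  refine h.congr (Filter.Eventually.of_forall fun x => ?_)
  simp only [exp_neg_two_pi_norm_eq x, subordinatedGaussian_eq]

lemma fourier_gaussian_norm {b : ℝ} (hb : 0 < b) (ξ : V) :
    𝓕 (fun x : V => (Real.exp (-b * ‖x‖ ^ 2) : ℂ)) ξ =
      (((Real.pi / b) ^ (Module.finrank ℝ V / 2 : ℝ) *
        Real.exp (-Real.pi ^ 2 * ‖ξ‖ ^ 2 / b) : ℝ) : ℂ) := by
  have h := fourier_gaussian_innerProductSpace (V := V) (b := b) (by simpa using hb) ξ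
  push_cast
  rw [Complex.ofReal_cpow (by positivity)]
  push_cast
  exact h

/-- The constant in the Fourier transform of `exp (-2π|x|)`. -/
noncomputable def besselConst (n : ℕ) : ℝ :=
  2 / √Real.pi * (Real.pi ^ (-(n / 2 : ℝ)) * (1 / 2 * Real.Gamma ((n + 1) / 2)))

lemma besselConst_pos (n : ℕ) : 0 < besselConst n := by
  have := Real.Gamma_pos_of_pos (s := ((n : ℝ) + 1) / 2) (by positivity)
  have := Real.pi_pos
  unfold besselConst
  positivity

lemma integral_subordinatedGaussian_mul_exp {s : ℝ} (hs : 0 < s) (ξ : V) :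
    ∫ x : V, Complex.exp (((-2 * Real.pi * inner ℝ x ξ : ℝ) : ℂ) * Complex.I) *
        (subordinatedGaussian (s, x) : ℂ) =
      ((Real.pi ^ (-(Module.finrank ℝ V / 2 : ℝ)) * (s ^ (Module.finrank ℝ V : ℝ) *
        Real.exp (-(1 + ‖ξ‖ ^ 2) * s ^ (2 : ℝ))) : ℝ) : ℂ) := by
  have h := fourier_gaussian_norm (V := V) (b := Real.pi ^ 2 / s ^ 2) (by positivity) ξ
  rw [Real.fourier_eq'] at h
  simp only [smul_eq_mul] at h
  have h1 : ∀ x : V, Complex.exp (((-2 * Real.pi * inner ℝ x ξ : ℝ) : ℂ) * Complex.I) *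
        (subordinatedGaussian (s, x) : ℂ) = (Real.exp (-s ^ 2) : ℂ) *
      (Complex.exp (((-2 * Real.pi * inner ℝ x ξ : ℝ) : ℂ) * Complex.I) *
        (Real.exp (-(Real.pi ^ 2 / s ^ 2) * ‖x‖ ^ 2) : ℂ)) := fun x => by
    simp only [subordinatedGaussian]
    push_cast
    ring
  simp_rw [h1]
  rw [integral_const_mul, h, ← Complex.ofReal_mul]
  congr 1
  have h2 : Real.pi / (Real.pi ^ 2 / s ^ 2) = Real.pi⁻¹ * s ^ 2 := by
    field_simp
  have h3 : Real.exp (-(1 + ‖ξ‖ ^ 2) * s ^ (2 : ℝ)) =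
      Real.exp (-s ^ 2) * Real.exp (-Real.pi ^ 2 * ‖ξ‖ ^ 2 / (Real.pi ^ 2 / s ^ 2)) := by
    rw [← Real.exp_add, Real.rpow_two]
    congr 1
    field_simp
    ring
  rw [h3, h2, Real.mul_rpow (by positivity) (by positivity), ← Real.rpow_natCast s 2,
    ← Real.rpow_mul hs.le, Real.inv_rpow Real.pi_pos.le, ← Real.rpow_neg Real.pi_pos.le]
  rw [show ((2 : ℕ) : ℝ) * (Module.finrank ℝ V / 2 : ℝ) = Module.finrank ℝ V by
    push_cast; ring]
  ring

/-- By Fubini, the Gaussian at scale s contributes a multiple of sⁿ exp(-(1+|ξ|²)s²), and the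
integral over s is a Gamma integral. -/
lemma fourier_exp_neg_two_pi_norm (ξ : V) :
    𝓕 (fun x : V => (Real.exp (-(2 * Real.pi * ‖x‖)) : ℂ)) ξ =
      ((besselConst (Module.finrank ℝ V) *
        (1 + ‖ξ‖ ^ 2) ^ (-((Module.finrank ℝ V : ℝ) + 1) / 2) : ℝ) : ℂ) := by
  rw [Real.fourier_eq']
  have h1 : ∀ x : V, Complex.exp (((-2 * Real.pi * inner ℝ x ξ : ℝ) : ℂ) * Complex.I) •
      (Real.exp (-(2 * Real.pi * ‖x‖)) : ℂ) = ((2 / √Real.pi : ℝ) : ℂ) *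
        ∫ s in Ioi (0 : ℝ), Complex.exp (((-2 * Real.pi * inner ℝ x ξ : ℝ) : ℂ) * Complex.I) *
          (subordinatedGaussian (s, x) : ℂ) := fun x => by
    rw [exp_neg_two_pi_norm_eq x, integral_const_mul, integral_complex_ofReal, smul_eq_mul]
    simp_rw [subordinatedGaussian_eq]
    push_cast
    ring
  simp_rw [h1]
  rw [integral_const_mul, ← integral_integral_swap]
  · have h2 : ∀ᵐ s ∂(volume.restrict (Ioi (0 : ℝ))),
        ∫ x : V, Complex.exp (((-2 * Real.pi * inner ℝ x ξ : ℝ) : ℂ) * Complex.I) *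
          (subordinatedGaussian (s, x) : ℂ) =
        ((Real.pi ^ (-(Module.finrank ℝ V / 2 : ℝ)) * (s ^ (Module.finrank ℝ V : ℝ) *
          Real.exp (-(1 + ‖ξ‖ ^ 2) * s ^ (2 : ℝ))) : ℝ) : ℂ) := by
      filter_upwards [ae_restrict_mem measurableSet_Ioi] with s hs
      exact integral_subordinatedGaussian_mul_exp hs ξ
    rw [integral_congr_ae h2, integral_complex_ofReal, integral_const_mul,
      integral_rpow_mul_exp_neg_mul_rpow two_pos
        (by linarith [(Module.finrank ℝ V).cast_nonneg (α := ℝ)]) (by positivity),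
      ← Complex.ofReal_mul]
    congr 1
    unfold besselConst
    ring
  · have hm : Continuous fun p : ℝ × V =>
        Complex.exp (((-2 * Real.pi * inner ℝ p.2 ξ : ℝ) : ℂ) * Complex.I) := by fun_prop
    refine (integrable_subordinatedGaussian (V := V)).ofReal.bdd_mul (c := 1)
      hm.aestronglyMeasurable (Filter.Eventually.of_forall fun p => ?_)
    rw [Complex.norm_exp_ofReal_mul_I]

end BesselPotential

/-! ### The kernel and its Fourier transform -/

section Kernel

variable {d : ℕ} {φ : EuclideanSpace ℝ (Fin d) → ℝ}

namespace IsProfile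

lemma hasCompactSupport (hφ : IsProfile φ) : HasCompactSupport φ :=
  HasCompactSupport.intro (isCompact_closedBall 0 (1 / 2)) fun ξ hξ =>
    hφ.support ξ (by simpa using (not_le.1 (fun h => hξ (by simpa using h))).le)

lemma integrable (hφ : IsProfile φ) : Integrable φ :=
  hφ.smooth.continuous.integrable_of_hasCompactSupport hφ.hasCompactSupport

lemma even (hφ : IsProfile φ) (ξ : EuclideanSpace ℝ (Fin d)) : φ (-ξ) = φ ξ :=
  hφ.radial _ _ (norm_neg ξ)

end IsProfile

lemma contDiff_kernelHat (hφ : IsProfile φ) : ContDiff ℝ ∞ (kernelHat φ) := by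
  have h1 : ContDiff ℝ ∞ (φ ⋆[ContinuousLinearMap.mul ℝ ℝ, volume] φ) :=
    hφ.hasCompactSupport.contDiff_convolution_left _ hφ.smooth hφ.integrable.locallyIntegrable
  have h2 : ContDiff ℝ ∞ fun ξ : EuclideanSpace ℝ (Fin d) => 1 + ‖ξ‖ ^ 2 :=
    contDiff_const.add (contDiff_norm_sq ℝ)
  exact (h2.rpow_const_of_ne fun ξ => by positivity).mul h1

lemma convolution_profile_eq_zero (hφ : IsProfile φ) {ξ : EuclideanSpace ℝ (Fin d)}
    (hξ : 1 ≤ ‖ξ‖) : (φ ⋆[ContinuousLinearMap.mul ℝ ℝ, volume] φ) ξ = 0 := by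
  rw [convolution_def]
  refine integral_eq_zero_of_ae (Filter.Eventually.of_forall fun t => ?_)
  simp only [ContinuousLinearMap.mul_apply', Pi.zero_apply]
  by_cases ht : 1 / 2 ≤ ‖t‖
  · rw [hφ.support t ht, zero_mul]
  · rw [hφ.support (ξ - t), mul_zero]
    have := norm_sub_norm_le ξ t
    linarith

lemma kernelHat_eq_zero (hφ : IsProfile φ) {ξ : EuclideanSpace ℝ (Fin d)}
    (hξ : 1 ≤ ‖ξ‖) : kernelHat φ ξ = 0 := by
  rw [kernelHat, convolution_profile_eq_zero hφ hξ, mul_zero]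

/-- The normalization ∫ φ² = 1 enters here, through the evenness of φ; it gives the kernel mass one.
-/
lemma kernelHat_zero (hφ : IsProfile φ) : kernelHat φ 0 = 1 := by
  have h : (φ ⋆[ContinuousLinearMap.mul ℝ ℝ, volume] φ) 0 = 1 := by
    rw [convolution_def, ← hφ.norm_sq]
    simp [hφ.even, sq]
  rw [kernelHat, h]
  simp

/-- The Fourier transform of the kernel as a complex-valued Schwartz function. -/
noncomputable def kernelHatSchwartz (hφ : IsProfile φ) :
    SchwartzMap (EuclideanSpace ℝ (Fin d)) ℂ :=
  HasCompactSupport.toSchwartzMap (f := fun ξ => (kernelHat φ ξ : ℂ))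
    (HasCompactSupport.intro (isCompact_closedBall 0 1) fun ξ hξ => by
      rw [kernelHat_eq_zero hφ (by simpa using (not_le.1 (fun h => hξ (by simpa using h))).le),
        Complex.ofReal_zero])
    (Complex.ofRealCLM.contDiff.comp (contDiff_kernelHat hφ))

lemma kernelHatSchwartz_coe (hφ : IsProfile φ) :
    ⇑(kernelHatSchwartz hφ) = fun ξ => (kernelHat φ ξ : ℂ) := rfl

/-- The profile as a complex-valued Schwartz function. -/
noncomputable def profileSchwartz (hφ : IsProfile φ) :
    SchwartzMap (EuclideanSpace ℝ (Fin d)) ℂ :=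
  HasCompactSupport.toSchwartzMap (f := fun ξ => (φ ξ : ℂ))
    (hφ.hasCompactSupport.comp_left (g := fun r : ℝ => (r : ℂ)) Complex.ofReal_zero)
    (Complex.ofRealCLM.contDiff.comp hφ.smooth)

/-- The real-valued inverse Fourier transform of the profile. -/
noncomputable def profileInv (φ : EuclideanSpace ℝ (Fin d) → ℝ)
    (x : EuclideanSpace ℝ (Fin d)) : ℝ :=
  (𝓕⁻ (fun ξ => (φ ξ : ℂ)) x).re

lemma ofReal_profileInv (hφ : IsProfile φ) (x : EuclideanSpace ℝ (Fin d)) :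
    (profileInv φ x : ℂ) = 𝓕⁻ (fun ξ => (φ ξ : ℂ)) x := by
  rw [profileInv, ← Complex.conj_eq_iff_re, Real.fourierInv_eq', ← integral_conj,
    ← integral_neg_eq_self]
  refine integral_congr_ae (Filter.Eventually.of_forall fun ξ => ?_)
  simp only [smul_eq_mul, map_mul, Complex.conj_ofReal, hφ.even, ← Complex.exp_conj,
    Complex.conj_I, inner_neg_left]
  congr 2
  push_cast
  ring

lemma integrable_profileInv_sq (hφ : IsProfile φ) : Integrable fun x => profileInv φ x ^ 2 := by
  have h : ∀ x, 𝓕⁻ (profileSchwartz hφ) x = (profileInv φ x : ℂ) := fun x => by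
    rw [ofReal_profileInv hφ, SchwartzMap.fourierInv_coe]
    rfl
  have h2 := (SchwartzMap.memLp (𝓕⁻ (profileSchwartz hφ)) 2).integrable_norm_pow two_ne_zero
  refine h2.congr (Filter.Eventually.of_forall fun x => ?_)
  simp [h]

/-- The convolution theorem produces a square, of a real function because φ is even. This is the
source of the positivity of the kernel. -/
lemma fourierInv_convolution_profile (hφ : IsProfile φ) (x : EuclideanSpace ℝ (Fin d)) :
    𝓕⁻ (fun ξ => ((φ ⋆[ContinuousLinearMap.mul ℝ ℝ, volume] φ) ξ : ℂ)) x =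
      ((profileInv φ x ^ 2 : ℝ) : ℂ) := by
  have h := Real.fourier_mul_convolution_eq (hφ.integrable.ofReal (𝕜 := ℂ))
    (hφ.integrable.ofReal (𝕜 := ℂ)) (-x)
  rw [← Real.fourierInv_eq_fourier_neg, ← Real.fourierInv_eq_fourier_neg] at h
  rw [Complex.ofReal_pow, ofReal_profileInv hφ, sq]
  refine Eq.trans ?_ h
  refine congrArg (fun f : EuclideanSpace ℝ (Fin d) → ℂ => (𝓕⁻ f : EuclideanSpace ℝ (Fin d) → ℂ) x)
    (funext fun ξ => ?_)
  rw [convolution_def, convolution_def, ← integral_complex_ofReal]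
  simp

lemma integrable_convolution_profile (hφ : IsProfile φ) :
    Integrable fun ξ => ((φ ⋆[ContinuousLinearMap.mul ℝ ℝ, volume] φ) ξ : ℂ) :=
  (hφ.integrable.integrable_convolution _ hφ.integrable).ofReal

/-- Self-adjointness of the Fourier transform, ∫ Ê g = ∫ E ĝ, with E = exp(-2π|·|) and g equal to φ
∗ φ modulated by x. Modulation of g translates its transform, so the right side is a convolution
evaluated at x. -/
lemma fourierInv_kernelHat (hφ : IsProfile φ) (x : EuclideanSpace ℝ (Fin d)) :
    𝓕⁻ (fun ξ => (kernelHat φ ξ : ℂ)) x =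
      (((besselConst d)⁻¹ * ∫ y, Real.exp (-(2 * Real.pi * ‖x - y‖)) * profileInv φ y ^ 2 : ℝ) :
        ℂ) := by
  set g : EuclideanSpace ℝ (Fin d) → ℂ := fun ξ =>
    Complex.exp (((2 * Real.pi * inner ℝ ξ x : ℝ) : ℂ) * Complex.I) *
      ((φ ⋆[ContinuousLinearMap.mul ℝ ℝ, volume] φ) ξ : ℂ) with hg
  have hgi : Integrable g := by
    refine (integrable_convolution_profile hφ).bdd_mul (c := 1)
      (by fun_prop) (Filter.Eventually.of_forall fun p => ?_)
    rw [Complex.norm_exp_ofReal_mul_I]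
  have hgF : ∀ y, 𝓕 g y = ((profileInv φ (x - y) ^ 2 : ℝ) : ℂ) := fun y => by
    rw [← fourierInv_convolution_profile hφ, Real.fourierInv_eq', Real.fourier_eq']
    refine integral_congr_ae (Filter.Eventually.of_forall fun ξ => ?_)
    simp only [hg, smul_eq_mul]
    rw [← mul_assoc, ← Complex.exp_add, inner_sub_right]
    congr 2
    push_cast
    ring
  have hE := (integrable_exp_neg_two_pi_norm (EuclideanSpace ℝ (Fin d))).ofReal (𝕜 := ℂ)
  have key := VectorFourier.integral_fourierIntegral_smul_eq_flip (𝕜 := ℝ) (e := Real.fourierChar)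
    (L := innerₗ (EuclideanSpace ℝ (Fin d))) (μ := volume) (ν := volume)
    Real.continuous_fourierChar continuous_inner hE hgi
  rw [flip_innerₗ] at key
  change ∫ ξ, 𝓕 (fun y : EuclideanSpace ℝ (Fin d) =>
    ((Real.exp (-(2 * Real.pi * ‖y‖)) : ℝ) : ℂ)) ξ • g ξ =
      ∫ y, ((Real.exp (-(2 * Real.pi * ‖y‖)) : ℝ) : ℂ) • 𝓕 g y at key
  simp_rw [fourier_exp_neg_two_pi_norm, hgF, smul_eq_mul, finrank_euclideanSpace_fin] at key
  have h1 : ∫ y, Real.exp (-(2 * Real.pi * ‖x - y‖)) * profileInv φ y ^ 2 =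
      ∫ y, Real.exp (-(2 * Real.pi * ‖y‖)) * profileInv φ (x - y) ^ 2 := by
    rw [← integral_sub_left_eq_self _ _ x]
    simp
  rw [h1, Complex.ofReal_mul, ← integral_complex_ofReal]
  simp_rw [Complex.ofReal_mul _ (profileInv φ _ ^ 2)]
  rw [← key, ← integral_const_mul, Real.fourierInv_eq']
  refine integral_congr_ae (Filter.Eventually.of_forall fun ξ => ?_)
  have hc : (besselConst d : ℂ) ≠ 0 := Complex.ofReal_ne_zero.2 (besselConst_pos d).ne'
  simp only [hg, kernelHat, smul_eq_mul, Complex.ofReal_mul, Complex.ofReal_inv]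
  field_simp

lemma ofReal_kernel (hφ : IsProfile φ) (x : EuclideanSpace ℝ (Fin d)) :
    (kernel φ x : ℂ) = 𝓕⁻ (fun ξ => (kernelHat φ ξ : ℂ)) x := by
  rw [kernel, fourierInv_kernelHat hφ, Complex.ofReal_re]

lemma kernel_eq_integral (hφ : IsProfile φ) (x : EuclideanSpace ℝ (Fin d)) :
    kernel φ x = (besselConst d)⁻¹ *
      ∫ y, Real.exp (-(2 * Real.pi * ‖x - y‖)) * profileInv φ y ^ 2 := by
  rw [kernel, fourierInv_kernelHat hφ, Complex.ofReal_re]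

lemma kernel_nonneg (hφ : IsProfile φ) (x : EuclideanSpace ℝ (Fin d)) : 0 ≤ kernel φ x := by
  rw [kernel_eq_integral hφ]
  exact mul_nonneg (inv_nonneg.2 (besselConst_pos d).le)
    (integral_nonneg fun y => by positivity)

lemma integrable_exp_mul_profileInv_sq (hφ : IsProfile φ) (x : EuclideanSpace ℝ (Fin d)) :
    Integrable fun y => Real.exp (-(2 * Real.pi * ‖x - y‖)) * profileInv φ y ^ 2 := by
  refine (integrable_profileInv_sq hφ).bdd_mul (c := 1) (by fun_prop)
    (Filter.Eventually.of_forall fun y => ?_)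
  rw [Real.norm_of_nonneg (Real.exp_pos _).le, Real.exp_le_one_iff, neg_nonpos]
  positivity

/-- A Harnack inequality, inherited from the exponential factor by the triangle inequality. -/
lemma kernel_add_le (hφ : IsProfile φ) (x z : EuclideanSpace ℝ (Fin d)) :
    kernel φ (x + z) ≤ Real.exp (2 * Real.pi * ‖z‖) * kernel φ x := by
  rw [kernel_eq_integral hφ, kernel_eq_integral hφ, mul_left_comm,
    ← integral_const_mul (Real.exp _)]
  refine mul_le_mul_of_nonneg_left ?_ (inv_nonneg.2 (besselConst_pos d).le)
  refine integral_mono (integrable_exp_mul_profileInv_sq hφ _)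
    ((integrable_exp_mul_profileInv_sq hφ x).const_mul _) fun y => ?_
  simp only
  rw [← mul_assoc, ← Real.exp_add]
  refine mul_le_mul_of_nonneg_right (Real.exp_le_exp.2 ?_) (sq_nonneg _)
  have h : ‖x - y‖ ≤ ‖x + z - y‖ + ‖z‖ := by
    calc ‖x - y‖ = ‖(x + z - y) - z‖ := by congr 1; abel
      _ ≤ _ := norm_sub_le _ _
  have := mul_le_mul_of_nonneg_left h Real.two_pi_pos.le
  linarith

lemma kernel_le_exp_mul_kernel_add (hφ : IsProfile φ) (x z : EuclideanSpace ℝ (Fin d)) :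
    kernel φ x ≤ Real.exp (2 * Real.pi * ‖z‖) * kernel φ (x + z) := by
  simpa using kernel_add_le hφ (x + z) (-z)

lemma fourierInv_kernelHatSchwartz (hφ : IsProfile φ) (x : EuclideanSpace ℝ (Fin d)) :
    𝓕⁻ (kernelHatSchwartz hφ) x = (kernel φ x : ℂ) := by
  rw [SchwartzMap.fourierInv_coe, ofReal_kernel hφ, kernelHatSchwartz_coe]

lemma integrable_norm_pow_mul_kernel (hφ : IsProfile φ) (n : ℕ) :
    Integrable fun x => ‖x‖ ^ n * kernel φ x := by
  refine (SchwartzMap.integrable_pow_mul volume (𝓕⁻ (kernelHatSchwartz hφ)) n).congr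
    (Filter.Eventually.of_forall fun x => ?_)
  simp only [fourierInv_kernelHatSchwartz, Complex.norm_real]
  rw [Real.norm_of_nonneg (kernel_nonneg hφ x)]

lemma integrable_kernel (hφ : IsProfile φ) : Integrable (kernel φ) := by
  simpa using integrable_norm_pow_mul_kernel hφ 0

lemma continuous_kernel (hφ : IsProfile φ) : Continuous (kernel φ) := by
  have h : kernel φ = fun x => (𝓕⁻ (kernelHatSchwartz hφ) x).re := by
    funext x
    rw [fourierInv_kernelHatSchwartz, Complex.ofReal_re]
  rw [h]
  exact Complex.continuous_re.comp (SchwartzMap.continuous _)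

lemma fourier_kernel (hφ : IsProfile φ) (ξ : EuclideanSpace ℝ (Fin d)) :
    𝓕 (fun x => (kernel φ x : ℂ)) ξ = (kernelHat φ ξ : ℂ) := by
  have h : (fun x => (kernel φ x : ℂ)) = ⇑(𝓕⁻ (kernelHatSchwartz hφ) : SchwartzMap (EuclideanSpace ℝ (Fin d)) ℂ) :=
    funext fun x => (fourierInv_kernelHatSchwartz hφ x).symm
  rw [h, ← SchwartzMap.fourier_coe, FourierTransform.fourier_fourierInv_eq, kernelHatSchwartz_coe]

lemma integral_kernel (hφ : IsProfile φ) : ∫ x, kernel φ x = 1 := by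
  have h := fourier_kernel hφ 0
  rw [kernelHat_zero hφ, Real.fourier_eq'] at h
  simp only [inner_zero_right, mul_zero, Complex.ofReal_zero, zero_mul, Complex.exp_zero,
    one_smul] at h
  rw [integral_complex_ofReal] at h
  exact_mod_cast h

lemma abs_kernelHat_le_one (hφ : IsProfile φ) (ξ : EuclideanSpace ℝ (Fin d)) :
    |kernelHat φ ξ| ≤ 1 := by
  have h : ‖(kernelHat φ ξ : ℂ)‖ ≤ ∫ x, ‖(kernel φ x : ℂ)‖ := by
    rw [← fourier_kernel hφ]
    exact VectorFourier.norm_fourierIntegral_le_integral_norm _ _ _ _ _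
  simp only [Complex.norm_real, Real.norm_of_nonneg (kernel_nonneg hφ _)] at h
  rwa [integral_kernel hφ] at h

/-- By the Harnack inequality a single zero would spread everywhere, contradicting mass one. -/
lemma kernel_pos (hφ : IsProfile φ) (x : EuclideanSpace ℝ (Fin d)) : 0 < kernel φ x := by
  refine (kernel_nonneg hφ x).lt_of_ne fun h => ?_
  have h0 : ∀ y, kernel φ y = 0 := fun y => by
    have h1 := kernel_add_le hφ x (y - x)
    rw [← h, mul_zero, add_sub_cancel] at h1
    exact le_antisymm h1 (kernel_nonneg hφ y)
  have h1 := integral_kernel hφ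
  simp [h0] at h1

lemma setIntegral_kernel_pos (hφ : IsProfile φ) :
    0 < ∫ y in Metric.closedBall (0 : EuclideanSpace ℝ (Fin d)) 1, kernel φ y := by
  rw [setIntegral_pos_iff_support_of_nonneg_ae
    (Filter.Eventually.of_forall fun y => kernel_nonneg hφ y) (integrable_kernel hφ).integrableOn]
  have h : Function.support (kernel φ) = univ := by
    ext y
    simp [(kernel_pos hφ y).ne']
  rw [h, univ_inter]
  exact Metric.measure_closedBall_pos _ _ one_pos

/-! ### The tail of the kernel -/

lemma measurableSet_tail (t : ℝ≥0∞) :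
    MeasurableSet {x : EuclideanSpace ℝ (Fin d) | t ≤ ENNReal.ofReal ‖x‖} :=
  measurableSet_le measurable_const (by fun_prop)

lemma kernelTail_nonneg (hφ : IsProfile φ) (t : ℝ≥0∞) : 0 ≤ kernelTail φ t :=
  setIntegral_nonneg (measurableSet_tail t) fun x _ => kernel_nonneg hφ x

lemma kernelTail_antitone (hφ : IsProfile φ) : Antitone (kernelTail φ) := fun _ _ hst =>
  setIntegral_mono_set (integrable_kernel hφ).integrableOn
    (Filter.Eventually.of_forall fun x => kernel_nonneg hφ x)
    (LE.le.eventuallyLE fun _ hx => hst.trans hx)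

lemma kernelTail_le_one (hφ : IsProfile φ) (t : ℝ≥0∞) : kernelTail φ t ≤ 1 := by
  rw [← integral_kernel hφ]
  exact setIntegral_le_integral (integrable_kernel hφ)
    (Filter.Eventually.of_forall fun x => kernel_nonneg hφ x)

/-- Translating the half-space by e pushes it outside the open unit ball, and the Harnack inequality
prices this translation at exp(2π). -/
lemma exp_neg_mul_setIntegral_halfSpace_le (hφ : IsProfile φ) {e : EuclideanSpace ℝ (Fin d)}
    (he : ‖e‖ = 1) :
    Real.exp (-(2 * Real.pi)) * ∫ y in {y | 0 ≤ inner ℝ y e}, kernel φ y ≤ kernelTail φ 1 := by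
  have hm : MeasurableSet {y : EuclideanSpace ℝ (Fin d) | 0 ≤ inner ℝ y e} :=
    measurableSet_le measurable_const (by fun_prop)
  have hshift : Integrable fun y => kernel φ (y + e) := (integrable_kernel hφ).comp_add_right e
  have h1 : Real.exp (-(2 * Real.pi)) * ∫ y in {y | 0 ≤ inner ℝ y e}, kernel φ y ≤
      ∫ y in {y | 0 ≤ inner ℝ y e}, kernel φ (y + e) := by
    rw [← integral_const_mul]
    refine integral_mono ((integrable_kernel hφ).integrableOn.const_mul _) hshift.integrableOn
      fun y => ?_
    have h := kernel_le_exp_mul_kernel_add hφ y e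
    rw [he, mul_one] at h
    simp only
    rw [Real.exp_neg, inv_mul_le_iff₀ (Real.exp_pos _)]
    exact h
  refine h1.trans ?_
  rw [kernelTail, ← integral_indicator hm, ← integral_indicator (measurableSet_tail 1),
    ← integral_add_right_eq_self
      ({x : EuclideanSpace ℝ (Fin d) | 1 ≤ ENNReal.ofReal ‖x‖}.indicator (kernel φ)) e]
  refine integral_mono (hshift.indicator hm)
    (((integrable_kernel hφ).indicator (measurableSet_tail 1)).comp_add_right e) fun y => ?_
  by_cases hy : 0 ≤ inner ℝ y e
  · have hy' : 1 ≤ ENNReal.ofReal ‖y + e‖ := by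
      rw [ENNReal.one_le_ofReal, ← one_le_sq_iff₀ (norm_nonneg _), norm_add_sq_real, he]
      nlinarith [sq_nonneg ‖y‖]
    rw [indicator_of_mem (by exact hy), indicator_of_mem (by exact hy')]
  · rw [indicator_of_notMem (by exact hy)]
    exact indicator_nonneg (fun x _ => kernel_nonneg hφ x) _

/-- Two opposite half-spaces cover the space, so their kernel masses add up to at least one. A unit
vector exists because the dimension is positive. -/
lemma exp_neg_div_two_le_kernelTail_one (hφ : IsProfile φ) (hd : 0 < d) :
    Real.exp (-(2 * Real.pi)) / 2 ≤ kernelTail φ 1 := by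
  set e : EuclideanSpace ℝ (Fin d) := EuclideanSpace.single ⟨0, hd⟩ 1
  have he : ‖e‖ = 1 := by simp [e]
  have h1 := exp_neg_mul_setIntegral_halfSpace_le hφ he
  have h2 := exp_neg_mul_setIntegral_halfSpace_le hφ (e := -e) (by rwa [norm_neg])
  have h3 : (1 : ℝ) ≤ (∫ y in {y | 0 ≤ inner ℝ y e}, kernel φ y) +
      ∫ y in {y | 0 ≤ inner ℝ y (-e)}, kernel φ y := by
    have hm : ∀ v : EuclideanSpace ℝ (Fin d),
        MeasurableSet {y : EuclideanSpace ℝ (Fin d) | 0 ≤ inner ℝ y v} := fun v =>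
      measurableSet_le measurable_const (by fun_prop)
    have hK := integrable_kernel hφ
    rw [← integral_kernel hφ, ← integral_indicator (hm _), ← integral_indicator (hm _),
      ← integral_add (hK.indicator (hm _)) (hK.indicator (hm _))]
    refine integral_mono hK ((hK.indicator (hm _)).add (hK.indicator (hm _))) fun y => ?_
    have h0 : ∀ v, 0 ≤ {y : EuclideanSpace ℝ (Fin d) | 0 ≤ inner ℝ y v}.indicator (kernel φ) y :=
      fun v => indicator_nonneg (fun x _ => kernel_nonneg hφ x) _
    rcases le_total 0 (inner ℝ y e) with hy | hy
    · refine le_add_of_le_of_nonneg ?_ (h0 _)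
      rw [indicator_of_mem (by exact hy)]
    · refine le_add_of_nonneg_of_le (h0 _) ?_
      rw [indicator_of_mem (by simpa [inner_neg_right] using hy)]
  have h4 := mul_le_mul_of_nonneg_left h3 (Real.exp_pos (-(2 * Real.pi))).le
  rw [mul_add] at h4
  linarith

end Kernel

/-! ### The majorant `ψ` -/

section Psi

variable {d : ℕ} {φ : EuclideanSpace ℝ (Fin d) → ℝ}

/-- The constant in front of the tail of the kernel in the definition of `ψ`. -/
noncomputable def psiConst (φ : EuclideanSpace ℝ (Fin d) → ℝ) : ℝ :=
  4 * (Real.exp (2 * Real.pi) *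
    (∫ y in Metric.closedBall (0 : EuclideanSpace ℝ (Fin d)) 1, kernel φ y)⁻¹)

lemma psi_eq (t : ℝ≥0∞) : psi φ t = psiConst φ * kernelTail φ (t / 2) := rfl

lemma psiConst_pos (hφ : IsProfile φ) : 0 < psiConst φ := by
  have := setIntegral_kernel_pos hφ
  unfold psiConst
  positivity

lemma psi_nonneg (hφ : IsProfile φ) (t : ℝ≥0∞) : 0 ≤ psi φ t :=
  mul_nonneg (psiConst_pos hφ).le (kernelTail_nonneg hφ _)

lemma psi_antitone (hφ : IsProfile φ) : Antitone (psi φ) := fun _ _ hst =>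
  mul_le_mul_of_nonneg_left (kernelTail_antitone hφ (ENNReal.div_le_div_right hst 2))
    (psiConst_pos hφ).le

lemma psi_le_psiConst (hφ : IsProfile φ) (t : ℝ≥0∞) : psi φ t ≤ psiConst φ :=
  mul_le_of_le_one_right (psiConst_pos hφ).le (kernelTail_le_one hφ _)

lemma psiConst_mul_setIntegral (hφ : IsProfile φ) :
    (∫ y in Metric.closedBall (0 : EuclideanSpace ℝ (Fin d)) 1, kernel φ y) * psiConst φ =
      4 * Real.exp (2 * Real.pi) := by
  have := (setIntegral_kernel_pos hφ).ne'
  unfold psiConst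
  field_simp

/-- This explains the constant in ψ. For t ≥ 1 one has (t+1)/2 ≤ t and monotonicity suffices. For t
≤ 1 the tail at (t+1)/2 is at least exp(-2π)/2, which the factor 4 exp(2π) raises above one. The
shift by 1 makes room for averaging over the unit ball. -/
lemma kernelTail_le_setIntegral_mul_psi (hφ : IsProfile φ) (hd : 0 < d) (t : ℝ≥0∞) :
    kernelTail φ t ≤
      (∫ y in Metric.closedBall (0 : EuclideanSpace ℝ (Fin d)) 1, kernel φ y) *
        psi φ (t + 1) := by
  rw [psi_eq, ← mul_assoc, psiConst_mul_setIntegral hφ]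
  have h1 : 1 ≤ Real.exp (2 * Real.pi) := Real.one_le_exp Real.two_pi_pos.le
  rcases le_total 1 t with ht | ht
  · have h2 : (t + 1) / 2 ≤ t := by
      refine ENNReal.div_le_of_le_mul ?_
      rw [mul_two]
      gcongr
    have h3 := kernelTail_antitone hφ h2
    have h4 := kernelTail_nonneg hφ t
    nlinarith
  · have h2 : (t + 1) / 2 ≤ 1 := by
      refine ENNReal.div_le_of_le_mul ?_
      rw [one_mul, ← one_add_one_eq_two]
      gcongr
    have h3 := (exp_neg_div_two_le_kernelTail_one hφ hd).trans (kernelTail_antitone hφ h2)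
    have h4 : Real.exp (2 * Real.pi) * Real.exp (-(2 * Real.pi)) = 1 := by
      rw [← Real.exp_add]
      simp
    have h5 := kernelTail_le_one hφ t
    nlinarith

end Psi

/-! ### Geometry of the torus -/

section Torus

variable {d : ℕ}

/-- The projection of the Euclidean space onto the torus. -/
def toTorus (v : EuclideanSpace ℝ (Fin d)) : UnitAddTorus (Fin d) := fun i => (v i : UnitAddCircle)

lemma toTorus_add (v w : EuclideanSpace ℝ (Fin d)) : toTorus (v + w) = toTorus v + toTorus w := by
  funext i
  simp [toTorus]

lemma toTorus_neg (v : EuclideanSpace ℝ (Fin d)) : toTorus (-v) = -toTorus v := by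
  funext i
  simp [toTorus]

lemma toTorus_sub (v w : EuclideanSpace ℝ (Fin d)) : toTorus (v - w) = toTorus v - toTorus w := by
  rw [sub_eq_add_neg, toTorus_add, toTorus_neg, sub_eq_add_neg]

lemma toTorus_zero : toTorus (0 : EuclideanSpace ℝ (Fin d)) = 0 := by
  funext i
  simp [toTorus]

lemma isOpenQuotientMap_toTorus : IsOpenQuotientMap (toTorus (d := d)) := by
  have h1 : IsOpenQuotientMap (Pi.map fun (_ : Fin d) (r : ℝ) => (r : UnitAddCircle)) :=
    IsOpenQuotientMap.piMap fun _ => QuotientAddGroup.isOpenQuotientMap_mk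
  exact h1.comp (EuclideanSpace.equiv (Fin d) ℝ).toHomeomorph.isOpenQuotientMap

@[fun_prop]
lemma continuous_toTorus : Continuous (toTorus (d := d)) := isOpenQuotientMap_toTorus.continuous

lemma norm_coe_unitAddCircle_le (r : ℝ) : ‖(r : UnitAddCircle)‖ ≤ |r| := by
  rw [UnitAddCircle.norm_eq]
  simpa using round_le r 0

lemma torusDist_sub_toTorus_le (x : UnitAddTorus (Fin d)) (v : EuclideanSpace ℝ (Fin d)) :
    torusDist x (x - toTorus v) ≤ ‖v‖ := by
  rw [torusDist, EuclideanSpace.norm_eq]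
  refine Real.sqrt_le_sqrt (Finset.sum_le_sum fun i _ => ?_)
  have h : x i - (x - toTorus v) i = ((v i : ℝ) : UnitAddCircle) := by
    simp [toTorus]
  rw [h, Real.norm_eq_abs]
  have := norm_coe_unitAddCircle_le (v i)
  gcongr

lemma torusDist_eq_norm (x y : UnitAddTorus (Fin d)) :
    torusDist x y = ‖(WithLp.toLp 2 fun i => ‖x i - y i‖ : EuclideanSpace ℝ (Fin d))‖ := by
  rw [torusDist, EuclideanSpace.norm_eq]
  simp

lemma torusDist_triangle (x y z : UnitAddTorus (Fin d)) :
    torusDist x z ≤ torusDist x y + torusDist y z := by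
  rw [torusDist_eq_norm x y, torusDist_eq_norm y z]
  refine le_trans ?_ (norm_add_le _ _)
  rw [torusDist, EuclideanSpace.norm_eq]
  refine Real.sqrt_le_sqrt (Finset.sum_le_sum fun i _ => ?_)
  have h : ‖x i - z i‖ ≤ ‖x i - y i‖ + ‖y i - z i‖ := norm_sub_le_norm_sub_add_norm_sub _ _ _
  simp only [PiLp.add_apply, Real.norm_eq_abs, sq_abs]
  gcongr

lemma torusDist_comm (x y : UnitAddTorus (Fin d)) : torusDist x y = torusDist y x := by
  simp only [torusDist, norm_sub_rev]

lemma continuous_torusDist_left (y : UnitAddTorus (Fin d)) : Continuous fun x => torusDist x y := by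
  unfold torusDist
  fun_prop

/-- The infimum may be uncountable, but an infimum of continuous functions is upper semicontinuous.
-/
lemma measurable_boundaryDist (Ω : Set (UnitAddTorus (Fin d))) : Measurable (boundaryDist Ω) := by
  refine UpperSemicontinuous.measurable ?_
  refine upperSemicontinuous_iInf fun y => upperSemicontinuous_iInf fun _ => ?_
  exact (ENNReal.continuous_ofReal.comp (continuous_torusDist_left y)).upperSemicontinuous

lemma boundaryDist_le_of_mem_frontier {Ω : Set (UnitAddTorus (Fin d))} (x : UnitAddTorus (Fin d))
    (v : EuclideanSpace ℝ (Fin d)) (h : x - toTorus v ∈ frontier Ω) :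
    boundaryDist Ω x ≤ ENNReal.ofReal ‖v‖ :=
  (iInf₂_le _ h).trans (ENNReal.ofReal_le_ofReal (torusDist_sub_toTorus_le x v))

lemma boundaryDist_sub_toTorus_le (Ω : Set (UnitAddTorus (Fin d))) (x : UnitAddTorus (Fin d))
    (v : EuclideanSpace ℝ (Fin d)) :
    boundaryDist Ω (x - toTorus v) ≤ boundaryDist Ω x + ENNReal.ofReal ‖v‖ := by
  rw [boundaryDist, boundaryDist, ENNReal.iInf₂_add]
  refine le_iInf₂ fun y hy => (iInf₂_le y hy).trans ?_
  have h1 : 0 ≤ torusDist x y := Real.sqrt_nonneg _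
  rw [← ENNReal.ofReal_add h1 (norm_nonneg v)]
  refine ENNReal.ofReal_le_ofReal ((torusDist_triangle _ x _).trans ?_)
  rw [torusDist_comm _ x, add_comm]
  gcongr
  exact torusDist_sub_toTorus_le x v

/-- A set that misses the frontier is covered by the disjoint open interiors of Ω and of its
complement. -/
lemma exists_mem_frontier_of_isPreconnected {X : Type*} [TopologicalSpace X] {s Ω : Set X}
    (hs : IsPreconnected s) {a b : X} (ha : a ∈ s) (hb : b ∈ s) (haΩ : a ∈ Ω) (hbΩ : b ∉ Ω) :
    ∃ z ∈ s, z ∈ frontier Ω := by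
  by_contra! h
  have hin : ∀ z ∈ s, z ∈ interior Ω ∪ interior Ωᶜ := fun z hz => by
    have := h z hz
    rw [frontier_eq_closure_inter_closure, closure_eq_compl_interior_compl,
      closure_eq_compl_interior_compl, compl_compl] at this
    by_contra h'
    exact this ⟨fun h1 => h' (Or.inr h1), fun h1 => h' (Or.inl h1)⟩
  obtain ⟨z, -, hz1, hz2⟩ := hs _ _ isOpen_interior isOpen_interior hin
    ⟨a, ha, (hin a ha).resolve_right fun h1 => interior_subset h1 haΩ⟩
    ⟨b, hb, (hin b hb).resolve_left fun h1 => hbΩ (interior_subset h1)⟩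
  exact interior_subset hz2 (interior_subset hz1)

/-- Within the distance to the boundary one stays on the same side. -/
lemma sub_toTorus_mem_iff {Ω : Set (UnitAddTorus (Fin d))} {x : UnitAddTorus (Fin d)}
    {v : EuclideanSpace ℝ (Fin d)} (h : ENNReal.ofReal ‖v‖ < boundaryDist Ω x) :
    x - toTorus v ∈ Ω ↔ x ∈ Ω := by
  have hs : IsPreconnected ((fun w => x - toTorus w) '' Metric.closedBall 0 ‖v‖) :=
    (convex_closedBall (0 : EuclideanSpace ℝ (Fin d)) ‖v‖).isPreconnected.image _
      (by fun_prop)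
  have h0 : x ∈ (fun w => x - toTorus w) '' Metric.closedBall 0 ‖v‖ :=
    ⟨0, by simp, by simp [toTorus_zero]⟩
  have h1 : x - toTorus v ∈ (fun w => x - toTorus w) '' Metric.closedBall 0 ‖v‖ :=
    ⟨v, by simp, rfl⟩
  have key : ∀ z ∈ (fun w => x - toTorus w) '' Metric.closedBall 0 ‖v‖, z ∉ frontier Ω := by
    rintro _ ⟨w, hw, rfl⟩ hz
    refine absurd h (not_lt.2 ((boundaryDist_le_of_mem_frontier x w hz).trans ?_))
    exact ENNReal.ofReal_le_ofReal (by simpa using hw)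
  constructor
  · intro hv
    by_contra hx
    obtain ⟨z, hz, hz'⟩ := exists_mem_frontier_of_isPreconnected hs h1 h0 hv hx
    exact key z hz hz'
  · intro hx
    by_contra hv
    obtain ⟨z, hz, hz'⟩ := exists_mem_frontier_of_isPreconnected hs h0 h1 hx hv
    exact key z hz hz'

end Torus

/-! ### Characters and Fourier coefficients on the torus -/

section Characters

variable {d : ℕ}

instance isProbabilityMeasure_volume_unitAddCircle :
    IsProbabilityMeasure (volume : Measure UnitAddCircle) :=
  ⟨by rw [AddCircle.measure_univ, ENNReal.ofReal_one]⟩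

lemma volume_unitAddCircle_eq :
    (volume : Measure UnitAddCircle) = AddCircle.haarAddCircle := by
  rw [AddCircle.volume_eq_smul_haarAddCircle, ENNReal.ofReal_one, one_smul]

lemma torusCoeff_eq_mFourierCoeff (f : UnitAddTorus (Fin d) → ℝ) (k : Fin d → ℤ) :
    torusCoeff f k = UnitAddTorus.mFourierCoeff (fun x => (f x : ℂ)) k := by
  have h : (volume : Measure (UnitAddTorus (Fin d))) =
      Measure.pi fun _ => AddCircle.haarAddCircle := by
    rw [volume_pi, volume_unitAddCircle_eq]
  rw [torusCoeff, h]
  simp only [mul_comm ((f _ : ℝ) : ℂ)]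
  rfl

lemma mFourier_add_apply (k : Fin d → ℤ) (x y : UnitAddTorus (Fin d)) :
    UnitAddTorus.mFourier k (x + y) = UnitAddTorus.mFourier k x * UnitAddTorus.mFourier k y := by
  simp only [UnitAddTorus.mFourier, ContinuousMap.coe_mk, ← Finset.prod_mul_distrib]
  refine Finset.prod_congr rfl fun i _ => ?_
  simp [fourier_apply, AddCircle.toCircle_add]

lemma norm_mFourier_apply (k : Fin d → ℤ) (x : UnitAddTorus (Fin d)) :
    ‖UnitAddTorus.mFourier k x‖ = 1 := by
  rw [UnitAddTorus.mFourier, ContinuousMap.coe_mk, norm_prod]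
  exact Finset.prod_eq_one fun i _ => Circle.norm_coe _

/-- An integer frequency as a vector. -/
noncomputable def freqVec (k : Fin d → ℤ) : EuclideanSpace ℝ (Fin d) :=
  WithLp.toLp 2 fun i => (k i : ℝ)

lemma norm_freqVec (k : Fin d → ℤ) : ‖freqVec k‖ = freqNorm k := by
  rw [EuclideanSpace.norm_eq, freqNorm]
  simp [freqVec]

lemma mFourier_neg_toTorus (k : Fin d → ℤ) (v : EuclideanSpace ℝ (Fin d)) :
    UnitAddTorus.mFourier (-k) (toTorus v) =
      Complex.exp (((-2 * Real.pi * inner ℝ v (freqVec k) : ℝ) : ℂ) * Complex.I) := by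
  simp only [UnitAddTorus.mFourier, ContinuousMap.coe_mk, toTorus, fourier_coe_apply,
    ← Complex.exp_sum]
  congr 1
  rw [PiLp.inner_apply, Finset.mul_sum]
  push_cast
  rw [Finset.sum_mul]
  refine Finset.sum_congr rfl fun i _ => ?_
  simp [freqVec]
  ring

end Characters

/-! ### Smoothing by the rescaled kernel -/

section Smoothing

variable {d : ℕ} {φ : EuclideanSpace ℝ (Fin d) → ℝ}

/-- The convolution on the torus of `f` with the kernel at scale `1 / R`. -/
noncomputable def smoothing (φ : EuclideanSpace ℝ (Fin d) → ℝ) (R : ℝ)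
    (f : UnitAddTorus (Fin d) → ℝ) (x : UnitAddTorus (Fin d)) : ℝ :=
  ∫ y, kernel φ y * f (x - toTorus (R⁻¹ • y))

lemma integrable_smoothing_integrand (hφ : IsProfile φ) (R : ℝ) {f : UnitAddTorus (Fin d) → ℝ}
    (hf : Measurable f) {B : ℝ} (hB : ∀ x, |f x| ≤ B) (x : UnitAddTorus (Fin d)) :
    Integrable fun y => kernel φ y * f (x - toTorus (R⁻¹ • y)) := by
  refine (integrable_kernel hφ).mul_bdd (c := B) ?_ (Filter.Eventually.of_forall fun y => hB _)
  exact (hf.comp (by fun_prop)).aestronglyMeasurable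

/-- Continuity permits identifying the smoothing with its Fourier series at every point. After
lifting to Euclidean space, a translation moves the base point from f, which is only measurable,
into the continuous kernel; the Harnack inequality supplies a local dominating function. -/
lemma continuous_smoothing (hφ : IsProfile φ) {R : ℝ} (hR : R ≠ 0) {f : UnitAddTorus (Fin d) → ℝ}
    (hf : Measurable f) {B : ℝ} (hB : ∀ x, |f x| ≤ B) : Continuous (smoothing φ R f) := by
  rw [← isOpenQuotientMap_toTorus.continuous_comp_iff]
  have h1 : smoothing φ R f ∘ toTorus =
      fun u => ∫ y, kernel φ (y + R • u) * f (toTorus (-(R⁻¹ • y))) := by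
    funext u
    simp only [Function.comp, smoothing]
    rw [← integral_add_right_eq_self _ (R • u)]
    refine integral_congr_ae (Filter.Eventually.of_forall fun y => ?_)
    simp only
    rw [← toTorus_sub, smul_add, smul_smul, inv_mul_cancel₀ hR, one_smul]
    congr 3
    abel
  rw [h1, continuous_iff_continuousAt]
  intro u₀
  refine continuousAt_of_dominated
    (bound := fun y => Real.exp (2 * Real.pi * |R|) * kernel φ (y + R • u₀) * B) ?_ ?_ ?_ ?_
  · refine Filter.Eventually.of_forall fun u => ?_
    exact (((continuous_kernel hφ).comp (by fun_prop)).measurable.mul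
      (hf.comp (by fun_prop))).aestronglyMeasurable
  · filter_upwards [Metric.ball_mem_nhds u₀ one_pos] with u hu
    refine Filter.Eventually.of_forall fun y => ?_
    rw [norm_mul, Real.norm_of_nonneg (kernel_nonneg hφ _)]
    refine mul_le_mul ?_ (hB _) (abs_nonneg _) ?_
    · have h := kernel_add_le hφ (y + R • u₀) (R • (u - u₀))
      have h2 : y + R • u₀ + R • (u - u₀) = y + R • u := by
        rw [smul_sub]
        abel
      rw [h2] at h
      refine h.trans (mul_le_mul_of_nonneg_right (Real.exp_le_exp.2 ?_) (kernel_nonneg hφ _))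
      rw [norm_smul, Real.norm_eq_abs]
      have h3 : ‖u - u₀‖ ≤ 1 := (mem_ball_iff_norm.1 hu).le
      have h4 : |R| * ‖u - u₀‖ ≤ |R| := mul_le_of_le_one_right (abs_nonneg R) h3
      exact mul_le_mul_of_nonneg_left h4 Real.two_pi_pos.le
    · exact mul_nonneg (Real.exp_pos _).le (kernel_nonneg hφ _)
  · exact (((integrable_kernel hφ).comp_add_right (R • u₀)).const_mul _).mul_const _
  · refine Filter.Eventually.of_forall fun y => Continuous.continuousAt ?_
    exact ((continuous_kernel hφ).comp (by fun_prop)).mul continuous_const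

lemma torusCoeff_translate (f : UnitAddTorus (Fin d) → ℝ) (k : Fin d → ℤ)
    (v : EuclideanSpace ℝ (Fin d)) :
    torusCoeff (fun x => f (x - toTorus v)) k =
      UnitAddTorus.mFourier (-k) (toTorus v) * torusCoeff f k := by
  rw [torusCoeff, torusCoeff, ← integral_const_mul, ← integral_add_right_eq_self _ (toTorus v)]
  refine integral_congr_ae (Filter.Eventually.of_forall fun x => ?_)
  simp only [add_sub_cancel_right, mFourier_add_apply]
  ring

lemma torusCoeff_smoothing (hφ : IsProfile φ) (R : ℝ) {f : UnitAddTorus (Fin d) → ℝ}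
    (hf : Measurable f) {B : ℝ} (hB : ∀ x, |f x| ≤ B) (k : Fin d → ℤ) :
    torusCoeff (smoothing φ R f) k = (kernelHat φ (R⁻¹ • freqVec k) : ℂ) * torusCoeff f k := by
  have h1 : ∀ x, (smoothing φ R f x : ℂ) * UnitAddTorus.mFourier (-k) x =
      ∫ y, (kernel φ y : ℂ) * ((f (x - toTorus (R⁻¹ • y)) : ℂ) * UnitAddTorus.mFourier (-k) x) :=
    fun x => by
      rw [smoothing, ← integral_complex_ofReal, ← integral_mul_const]
      refine integral_congr_ae (Filter.Eventually.of_forall fun y => ?_)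
      push_cast
      ring
  rw [torusCoeff]
  simp_rw [h1]
  rw [integral_integral_swap]
  · have h2 : ∀ y, ∫ x, (kernel φ y : ℂ) *
        ((f (x - toTorus (R⁻¹ • y)) : ℂ) * UnitAddTorus.mFourier (-k) x) =
        (Complex.exp (((-2 * Real.pi * inner ℝ y (R⁻¹ • freqVec k) : ℝ) : ℂ) * Complex.I) *
          (kernel φ y : ℂ)) * torusCoeff f k := fun y => by
      rw [integral_const_mul]
      have h3 := torusCoeff_translate f k (R⁻¹ • y)
      rw [torusCoeff] at h3
      rw [h3, mFourier_neg_toTorus, real_inner_smul_left, real_inner_smul_right]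
      ring
    simp_rw [h2]
    rw [integral_mul_const, ← fourier_kernel hφ, Real.fourier_eq']
    rfl
  · have hi : Integrable (fun p : UnitAddTorus (Fin d) × EuclideanSpace ℝ (Fin d) =>
        (1 : ℂ) * (kernel φ p.2 : ℂ)) (volume.prod volume) :=
      (integrable_const (1 : ℂ)).mul_prod (integrable_kernel hφ).ofReal
    simp only [one_mul] at hi
    refine hi.mul_bdd (c := B) ?_ (Filter.Eventually.of_forall fun p => ?_)
    · have hm : Measurable fun p : UnitAddTorus (Fin d) × EuclideanSpace ℝ (Fin d) =>
          f (p.1 - toTorus (R⁻¹ • p.2)) := hf.comp (by fun_prop)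
      exact ((Complex.measurable_ofReal.comp hm).mul (by fun_prop)).aestronglyMeasurable
    · rw [norm_mul, norm_mFourier_apply, mul_one, Complex.norm_real]
      exact hB _

lemma abs_le_freqNorm (k : Fin d → ℤ) (i : Fin d) : |(k i : ℝ)| ≤ freqNorm k := by
  rw [← norm_freqVec]
  simpa [freqVec] using PiLp.norm_apply_le (freqVec k) i

lemma finite_freqNorm_lt (d : ℕ) (R : ℝ) : {k : Fin d → ℤ | freqNorm k < R}.Finite := by
  refine (Set.finite_Icc (fun _ => -⌈R⌉) (fun _ => ⌈R⌉)).subset fun k hk => ?_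
  have h : ∀ i, |k i| ≤ ⌈R⌉ := fun i => by
    have h1 : ((|k i| : ℤ) : ℝ) ≤ (⌈R⌉ : ℝ) := by
      rw [Int.cast_abs]
      exact (abs_le_freqNorm k i).trans ((le_of_lt hk).trans (Int.le_ceil R))
    exact_mod_cast h1
  exact ⟨fun i => (abs_le.1 (h i)).1, fun i => (abs_le.1 (h i)).2⟩

/-- The frequencies of norm less than `R`. -/
noncomputable def freqBall (d : ℕ) (R : ℝ) : Finset (Fin d → ℤ) := (finite_freqNorm_lt d R).toFinset

lemma mem_freqBall {R : ℝ} {k : Fin d → ℤ} : k ∈ freqBall d R ↔ freqNorm k < R := by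
  simp [freqBall]

lemma zero_mem_freqBall {R : ℝ} (hR : 0 < R) : (0 : Fin d → ℤ) ∈ freqBall d R := by
  simpa [mem_freqBall, freqNorm] using hR

/-- The smoothing is a trigonometric polynomial with frequencies of norm less than `R`. -/
lemma smoothing_eq_sum (hφ : IsProfile φ) {R : ℝ} (hR : 0 < R) {f : UnitAddTorus (Fin d) → ℝ}
    (hf : Measurable f) {B : ℝ} (hB : ∀ x, |f x| ≤ B) (x : UnitAddTorus (Fin d)) :
    (smoothing φ R f x : ℂ) = ∑ k ∈ freqBall d R,
      (kernelHat φ (R⁻¹ • freqVec k) : ℂ) * torusCoeff f k * UnitAddTorus.mFourier k x := by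
  let g : C(UnitAddTorus (Fin d), ℂ) := ⟨fun x => (smoothing φ R f x : ℂ),
    Complex.continuous_ofReal.comp (continuous_smoothing hφ hR.ne' hf hB)⟩
  have hg : ∀ k, UnitAddTorus.mFourierCoeff g k =
      (kernelHat φ (R⁻¹ • freqVec k) : ℂ) * torusCoeff f k := fun k => by
    rw [← torusCoeff_smoothing hφ R hf hB, torusCoeff_eq_mFourierCoeff]
    rfl
  -- The spectrum of the kernel lies in the unit ball, so no frequency of norm at least R survives.
  have h0 : ∀ k ∉ freqBall d R, UnitAddTorus.mFourierCoeff g k = 0 := fun k hk => by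
    rw [hg, kernelHat_eq_zero hφ, Complex.ofReal_zero, zero_mul]
    rw [mem_freqBall, not_lt] at hk
    rw [norm_smul, norm_freqVec, Real.norm_of_nonneg (inv_nonneg.2 hR.le), inv_mul_eq_div,
      one_le_div hR]
    exact hk
  have h1 := UnitAddTorus.hasSum_mFourier_series_apply_of_summable (f := g)
    (summable_of_ne_finset_zero h0) x
  have h2 : HasSum (fun k => UnitAddTorus.mFourierCoeff g k • UnitAddTorus.mFourier k x)
      (∑ k ∈ freqBall d R, UnitAddTorus.mFourierCoeff g k • UnitAddTorus.mFourier k x) :=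
    hasSum_sum_of_ne_finset_zero fun k hk => by rw [h0 k hk, zero_smul]
  have h3 := h1.unique h2
  simp_rw [hg, smul_eq_mul] at h3
  exact h3

end Smoothing

/-! ### The Erdős–Turán inequality -/

section ErdosTuranInequality

variable {d : ℕ} {φ : EuclideanSpace ℝ (Fin d) → ℝ} {Ω : Set (UnitAddTorus (Fin d))}

/-- A Borel set that agrees with `Ω` almost everywhere, and everywhere off the boundary of `Ω`. -/
def borelModification (Ω : Set (UnitAddTorus (Fin d))) : Set (UnitAddTorus (Fin d)) :=
  toMeasurable volume Ω ∩ frontier Ω ∪ interior Ω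

lemma measurableSet_borelModification : MeasurableSet (borelModification Ω) :=
  ((measurableSet_toMeasurable _ _).inter isClosed_frontier.measurableSet).union
    isOpen_interior.measurableSet

lemma self_eq_inter_frontier_union_interior : Ω = Ω ∩ frontier Ω ∪ interior Ω := by
  ext x
  constructor
  · intro hx
    by_cases h : x ∈ interior Ω
    · exact Or.inr h
    · exact Or.inl ⟨hx, subset_closure hx, h⟩
  · rintro (h | h)
    · exact h.1
    · exact interior_subset h

/-- Only a null subset of the frontier is altered. The smoothing needs a Borel function, whereas the
pointwise comparison needs exact agreement off the frontier; the modification meets both demands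
when Ω is merely null-measurable. -/
lemma borelModification_ae_eq (hΩ : NullMeasurableSet Ω) :
    borelModification Ω =ᵐ[volume] Ω := by
  conv_rhs => rw [self_eq_inter_frontier_union_interior (Ω := Ω)]
  exact (hΩ.toMeasurable_ae_eq.inter (ae_eq_refl _)).union (ae_eq_refl _)

lemma mem_borelModification_iff {x : UnitAddTorus (Fin d)} (hx : x ∉ frontier Ω) :
    x ∈ borelModification Ω ↔ x ∈ Ω := by
  conv_rhs => rw [self_eq_inter_frontier_union_interior (Ω := Ω)]
  simp [borelModification, hx]

lemma measurable_indicator_borelModification :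
    Measurable ((borelModification Ω).indicator fun _ => (1 : ℝ)) :=
  measurable_const.indicator measurableSet_borelModification

lemma abs_indicator_one_le {X : Type*} (s : Set X) (x : X) :
    |s.indicator (fun _ => (1 : ℝ)) x| ≤ 1 := by
  by_cases hx : x ∈ s <;> simp [hx]

lemma torusCoeff_indicator_borelModification (hΩ : NullMeasurableSet Ω) (k : Fin d → ℤ) :
    torusCoeff ((borelModification Ω).indicator fun _ => 1) k =
      torusCoeff (Ω.indicator fun _ => 1) k := by
  refine integral_congr_ae ?_
  filter_upwards [indicator_ae_eq_of_ae_eq_set (f := fun _ => (1 : ℝ))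
    (borelModification_ae_eq hΩ)] with x hx
  rw [hx]

lemma torusCoeff_indicator_zero (hΩ : NullMeasurableSet Ω) :
    torusCoeff (Ω.indicator fun _ => 1) 0 = (volume.real Ω : ℂ) := by
  simp only [torusCoeff, neg_zero, UnitAddTorus.mFourier_zero, ContinuousMap.one_apply, mul_one]
  rw [integral_complex_ofReal, integral_indicator₀ hΩ]
  simp

/-- The indicator function differs from its smoothing by at most the tail of the kernel. -/
lemma abs_indicator_sub_smoothing_le (hφ : IsProfile φ) {R : ℝ} (hR : 0 < R)
    (x : UnitAddTorus (Fin d)) :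
    |Ω.indicator (fun _ => (1 : ℝ)) x -
      smoothing φ R ((borelModification Ω).indicator fun _ => 1) x| ≤
      kernelTail φ (ENNReal.ofReal R * boundaryDist Ω x) := by
  set t := ENNReal.ofReal R * boundaryDist Ω x with ht
  set χ : ℝ := Ω.indicator (fun _ => (1 : ℝ)) x with hχ
  have hi := integrable_smoothing_integrand hφ R
    (measurable_indicator_borelModification (Ω := Ω)) (abs_indicator_one_le _) x
  have h1 : χ - smoothing φ R ((borelModification Ω).indicator fun _ => 1) x =
      ∫ y, (kernel φ y * χ - kernel φ y *
        (borelModification Ω).indicator (fun _ => 1) (x - toTorus (R⁻¹ • y))) := by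
    rw [integral_sub ((integrable_kernel hφ).mul_const _) hi, integral_mul_const,
      integral_kernel hφ, one_mul, smoothing]
  rw [h1, kernelTail, ← integral_indicator (measurableSet_tail t), ← Real.norm_eq_abs]
  refine norm_integral_le_of_norm_le ((integrable_kernel hφ).indicator (measurableSet_tail t))
    (Filter.Eventually.of_forall fun y => ?_)
  rw [← mul_sub, norm_mul, Real.norm_of_nonneg (kernel_nonneg hφ y), Real.norm_eq_abs]
  -- In the tail the two indicators differ by at most 1. For smaller y the translation stays within
  -- the boundary distance, so the indicators agree.
  by_cases hy : t ≤ ENNReal.ofReal ‖y‖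
  · rw [indicator_of_mem (show y ∈ {x | t ≤ ENNReal.ofReal ‖x‖} from hy)]
    refine mul_le_of_le_one_right (kernel_nonneg hφ y) ?_
    rw [abs_le, hχ]
    by_cases h1 : x ∈ Ω <;>
      by_cases h2 : x - toTorus (R⁻¹ • y) ∈ borelModification Ω <;> simp [h1, h2]
  · have hlt : ENNReal.ofReal ‖R⁻¹ • y‖ < boundaryDist Ω x := by
      rw [not_le, ht] at hy
      rw [norm_smul, Real.norm_of_nonneg (inv_nonneg.2 hR.le),
        ENNReal.ofReal_mul (inv_nonneg.2 hR.le), ENNReal.ofReal_inv_of_pos hR, mul_comm,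
        ← div_eq_mul_inv]
      refine ENNReal.div_lt_of_lt_mul' hy
    have hmem : x - toTorus (R⁻¹ • y) ∈ borelModification Ω ↔ x ∈ Ω := by
      rw [mem_borelModification_iff, sub_toTorus_mem_iff hlt]
      exact fun h => absurd hlt (not_lt.2 (boundaryDist_le_of_mem_frontier _ _ h))
    have h0 : χ - (borelModification Ω).indicator (fun _ => 1) (x - toTorus (R⁻¹ • y)) = 0 := by
      rw [hχ]
      by_cases h : x ∈ Ω <;> simp [hmem, h]
    rw [h0, abs_zero, mul_zero]
    exact indicator_nonneg (fun x _ => kernel_nonneg hφ x) _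

/-- The majorant of the boundary layer of width `1 / R`. -/
noncomputable def boundaryLayer (φ : EuclideanSpace ℝ (Fin d) → ℝ) (R : ℝ)
    (Ω : Set (UnitAddTorus (Fin d))) (x : UnitAddTorus (Fin d)) : ℝ :=
  psi φ (ENNReal.ofReal R * boundaryDist Ω x)

lemma measurable_boundaryLayer (hφ : IsProfile φ) (R : ℝ) : Measurable (boundaryLayer φ R Ω) :=
  (psi_antitone hφ).measurable.comp ((measurable_boundaryDist Ω).const_mul _)

lemma abs_boundaryLayer_le (hφ : IsProfile φ) (R : ℝ) (x : UnitAddTorus (Fin d)) :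
    |boundaryLayer φ R Ω x| ≤ psiConst φ := by
  rw [boundaryLayer, abs_of_nonneg (psi_nonneg hφ _)]
  exact psi_le_psiConst hφ _

/-- The convolution is restricted to |y| ≤ 1. There the translation by y/R raises R dist(·, ∂Ω) by
at most 1, so the integrand is at least the kernel times ψ(t+1), where t is the value of R dist(·,
∂Ω) at x. -/
lemma kernelTail_le_smoothing (hφ : IsProfile φ) (hd : 0 < d) {R : ℝ} (hR : 0 < R)
    (x : UnitAddTorus (Fin d)) :
    kernelTail φ (ENNReal.ofReal R * boundaryDist Ω x) ≤
      smoothing φ R (boundaryLayer φ R Ω) x := by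
  have hi := integrable_smoothing_integrand hφ R (measurable_boundaryLayer (Ω := Ω) hφ R)
    (abs_boundaryLayer_le hφ R) x
  refine (kernelTail_le_setIntegral_mul_psi hφ hd _).trans ?_
  rw [← integral_mul_const]
  refine le_trans ?_ (setIntegral_le_integral (s := Metric.closedBall 0 1) hi
    (Filter.Eventually.of_forall fun y => mul_nonneg (kernel_nonneg hφ y) (psi_nonneg hφ _)))
  refine setIntegral_mono_on ((integrable_kernel hφ).integrableOn.mul_const _) hi.integrableOn
    Metric.isClosed_closedBall.measurableSet fun y hy => ?_
  refine mul_le_mul_of_nonneg_left (psi_antitone hφ ?_) (kernel_nonneg hφ y)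
  have h1 := mul_le_mul_right (boundaryDist_sub_toTorus_le Ω x (R⁻¹ • y)) (ENNReal.ofReal R)
  refine h1.trans ?_
  rw [mul_add]
  gcongr
  rw [← ENNReal.ofReal_mul hR.le, norm_smul, Real.norm_of_nonneg (inv_nonneg.2 hR.le),
    ← mul_assoc, mul_inv_cancel₀ hR.ne', one_mul, ENNReal.ofReal_le_one]
  simpa using hy

lemma abs_indicator_sub_smoothing_le_smoothing (hφ : IsProfile φ) (hd : 0 < d) {R : ℝ} (hR : 0 < R)
    (x : UnitAddTorus (Fin d)) :
    |Ω.indicator (fun _ => (1 : ℝ)) x -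
      smoothing φ R ((borelModification Ω).indicator fun _ => 1) x| ≤
      smoothing φ R (boundaryLayer φ R Ω) x :=
  (abs_indicator_sub_smoothing_le hφ hR x).trans (kernelTail_le_smoothing hφ hd hR x)

/-- The normalized exponential sum along the multiples of `x`. -/
noncomputable def expSum (x : UnitAddTorus (Fin d)) (m : ℕ) (k : Fin d → ℤ) : ℂ :=
  (m : ℂ)⁻¹ * ∑ j ∈ Finset.Icc 1 m, UnitAddTorus.mFourier k (j • x)

/-- The average of a smoothing along the multiples of `x` differs from the mean by at most a
weighted sum of exponential sums. -/
lemma norm_average_smoothing_sub_le (hφ : IsProfile φ) {R : ℝ} (hR : 0 < R)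
    {f : UnitAddTorus (Fin d) → ℝ} (hf : Measurable f) {B : ℝ} (hB : ∀ x, |f x| ≤ B)
    (x : UnitAddTorus (Fin d)) {m : ℕ} (hm : 0 < m) :
    ‖(((m : ℝ)⁻¹ * ∑ j ∈ Finset.Icc 1 m, smoothing φ R f (j • x) : ℝ) : ℂ) - torusCoeff f 0‖ ≤
      ∑ k ∈ (freqBall d R).erase 0, ‖torusCoeff f k‖ * ‖expSum x m k‖ := by
  have hm' : (m : ℂ) ≠ 0 := Nat.cast_ne_zero.2 hm.ne'
  have h1 : (((m : ℝ)⁻¹ * ∑ j ∈ Finset.Icc 1 m, smoothing φ R f (j • x) : ℝ) : ℂ) =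
      ∑ k ∈ freqBall d R, (kernelHat φ (R⁻¹ • freqVec k) : ℂ) * torusCoeff f k * expSum x m k := by
    push_cast
    simp_rw [smoothing_eq_sum hφ hR hf hB, expSum]
    rw [Finset.sum_comm, Finset.mul_sum]
    refine Finset.sum_congr rfl fun k _ => ?_
    rw [← Finset.mul_sum]
    ring
  have h0 : (kernelHat φ (R⁻¹ • freqVec (0 : Fin d → ℤ)) : ℂ) * torusCoeff f 0 * expSum x m 0 =
      torusCoeff f 0 := by
    have h2 : freqVec (0 : Fin d → ℤ) = 0 := by
      ext i
      simp [freqVec]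
    have h3 : expSum x m 0 = 1 := by
      simp [expSum, UnitAddTorus.mFourier_zero, hm']
    rw [h2, smul_zero, kernelHat_zero hφ, h3]
    simp
  rw [h1, ← Finset.add_sum_erase _ _ (zero_mem_freqBall hR), h0, add_sub_cancel_left]
  refine (norm_sum_le _ _).trans (Finset.sum_le_sum fun k _ => ?_)
  rw [norm_mul, norm_mul, Complex.norm_real, Real.norm_eq_abs]
  refine mul_le_mul_of_nonneg_right ?_ (norm_nonneg _)
  exact mul_le_of_le_one_left (norm_nonneg _) (abs_kernelHat_le_one hφ _)

/-- The Erdős–Turán inequality for the arithmetic progression `x, 2x, …, mx`. -/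
theorem discrepancy_le (hφ : IsProfile φ) (hd : 0 < d) (hΩ : NullMeasurableSet Ω) {R : ℝ}
    (hR : 0 < R) (x : UnitAddTorus (Fin d)) {m : ℕ} (hm : 0 < m) :
    discrepancy x m Ω ≤ ‖torusCoeff (boundaryLayer φ R Ω) 0‖ +
      ∑ k ∈ (freqBall d R).erase 0, (‖torusCoeff (Ω.indicator fun _ => 1) k‖ +
        ‖torusCoeff (boundaryLayer φ R Ω) k‖) * ‖expSum x m k‖ := by
  have hm' : (0 : ℝ) < m := Nat.cast_pos.2 hm
  set f : UnitAddTorus (Fin d) → ℝ := (borelModification Ω).indicator fun _ => 1 with hf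
  have h1 := norm_average_smoothing_sub_le hφ hR
    (measurable_indicator_borelModification (Ω := Ω)) (abs_indicator_one_le _) x hm
  have h2 := norm_average_smoothing_sub_le hφ hR (measurable_boundaryLayer (Ω := Ω) hφ R)
    (abs_boundaryLayer_le hφ R) x hm
  simp only [torusCoeff_indicator_borelModification hΩ] at h1
  rw [torusCoeff_indicator_zero hΩ, ← Complex.ofReal_sub, Complex.norm_real, Real.norm_eq_abs,
    abs_sub_comm] at h1
  have h3 : |(m : ℝ)⁻¹ * ∑ j ∈ Finset.Icc 1 m, smoothing φ R f (j • x) -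
      (m : ℝ)⁻¹ * ∑ j ∈ Finset.Icc 1 m, Ω.indicator (fun _ => (1 : ℝ)) (j • x)| ≤
      (m : ℝ)⁻¹ * ∑ j ∈ Finset.Icc 1 m, smoothing φ R (boundaryLayer φ R Ω) (j • x) := by
    rw [← mul_sub, abs_mul, abs_of_pos (inv_pos.2 hm'), ← Finset.sum_sub_distrib]
    refine mul_le_mul_of_nonneg_left ?_ (inv_pos.2 hm').le
    refine (Finset.abs_sum_le_sum_abs _ _).trans (Finset.sum_le_sum fun j _ => ?_)
    rw [abs_sub_comm]
    exact abs_indicator_sub_smoothing_le_smoothing hφ hd hR _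
  have h4 : (m : ℝ)⁻¹ * ∑ j ∈ Finset.Icc 1 m, smoothing φ R (boundaryLayer φ R Ω) (j • x) ≤
      ‖torusCoeff (boundaryLayer φ R Ω) 0‖ +
        ∑ k ∈ (freqBall d R).erase 0, ‖torusCoeff (boundaryLayer φ R Ω) k‖ * ‖expSum x m k‖ := by
    refine (le_abs_self _).trans ?_
    rw [← Real.norm_eq_abs, ← Complex.norm_real]
    exact (norm_le_insert' _ _).trans (add_le_add_right h2 _)
  have h5 := abs_sub_le (volume.real Ω)
    ((m : ℝ)⁻¹ * ∑ j ∈ Finset.Icc 1 m, smoothing φ R f (j • x))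
    ((m : ℝ)⁻¹ * ∑ j ∈ Finset.Icc 1 m, Ω.indicator (fun _ => (1 : ℝ)) (j • x))
  simp only [add_mul, Finset.sum_add_distrib]
  rw [discrepancy]
  linarith

end ErdosTuranInequality

/-! ### Summability over the integer lattice -/

section Summability

/-- Any finite set of tuples lies in a box, over which the sum factors. -/
lemma summable_prod_pi {ι α : Type*} [Fintype ι] {f : α → ℝ} (hf : ∀ a, 0 ≤ f a)
    (hs : Summable f) : Summable fun k : ι → α => ∏ i, f (k i) := by
  classical
  refine summable_of_sum_le (c := ∏ _i : ι, ∑' a, f a) (fun k => Finset.prod_nonneg fun i _ => hf _)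
    fun u => ?_
  have hsub : u ⊆ Fintype.piFinset fun i => u.image fun k => k i := fun k hk =>
    Fintype.mem_piFinset.2 fun i => Finset.mem_image_of_mem _ hk
  refine (Finset.sum_le_sum_of_subset_of_nonneg hsub fun k _ _ =>
    Finset.prod_nonneg fun i _ => hf _).trans ?_
  rw [← Finset.prod_univ_sum (fun i => u.image fun k => k i) fun _ a => f a]
  exact Finset.prod_le_prod (fun i _ => Finset.sum_nonneg fun a _ => hf a)
    fun i _ => hs.sum_le_tsum _ fun a _ => hf a

/-- The summable weight `1 / ((n + 1) log (n + 2) ^ (1 + δ))`. -/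
noncomputable def logWeight (δ : ℝ) (n : ℕ) : ℝ :=
  (((n : ℝ) + 1) * Real.log (n + 2) ^ (1 + δ))⁻¹

lemma log_add_two_pos (n : ℕ) : 0 < Real.log ((n : ℝ) + 2) :=
  Real.log_pos (by linarith [n.cast_nonneg (α := ℝ)])

lemma logWeight_pos (δ : ℝ) (n : ℕ) : 0 < logWeight δ n := by
  have := log_add_two_pos n
  unfold logWeight
  positivity

lemma logWeight_antitone {δ : ℝ} (hδ : 0 < δ) : Antitone (logWeight δ) := by
  intro m n hmn
  have := log_add_two_pos m
  have h : (m : ℝ) ≤ n := Nat.cast_le.2 hmn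
  unfold logWeight
  gcongr

/-- Cauchy condensation: the dyadic block at 2ⁿ contributes at most a constant times (n+1)^{-(1+δ)}.
-/
lemma summable_logWeight {δ : ℝ} (hδ : 0 < δ) : Summable (logWeight δ) := by
  rw [← summable_condensed_iff_of_nonneg (fun n => (logWeight_pos δ n).le)
    fun m n _ hmn => logWeight_antitone hδ hmn]
  have h1 : Summable fun n : ℕ => (((n + 1 : ℕ) : ℝ) ^ (1 + δ))⁻¹ :=
    (summable_nat_add_iff 1).2 (Real.summable_nat_rpow_inv.2 (by linarith))
  refine Summable.of_nonneg_of_le (fun n => mul_nonneg (by positivity) (logWeight_pos δ _).le)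
    (fun n => ?_) (h1.mul_left (((Real.log 2 / 2) ^ (1 + δ))⁻¹))
  have hl2 : 0 < Real.log 2 := Real.log_pos one_lt_two
  have h2 : ((n + 1 : ℕ) : ℝ) * (Real.log 2 / 2) ≤ Real.log (((2 ^ n : ℕ) : ℝ) + 2) := by
    have h3 : (n : ℝ) * Real.log 2 ≤ Real.log (((2 ^ n : ℕ) : ℝ) + 2) := by
      rw [← Real.log_pow]
      refine Real.log_le_log (by positivity) ?_
      push_cast
      linarith
    have h4 : Real.log 2 ≤ Real.log (((2 ^ n : ℕ) : ℝ) + 2) :=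
      Real.log_le_log two_pos (by linarith [(2 ^ n).cast_nonneg (α := ℝ)])
    push_cast at h3 h4 ⊢
    linarith
  rw [← mul_inv, ← Real.mul_rpow (x := Real.log 2 / 2) (y := ((n + 1 : ℕ) : ℝ))
    (half_pos hl2).le (Nat.cast_nonneg _), mul_comm (Real.log 2 / 2)]
  have h5 : (((n + 1 : ℕ) : ℝ) * (Real.log 2 / 2)) ^ (1 + δ) ≤
      Real.log (((2 ^ n : ℕ) : ℝ) + 2) ^ (1 + δ) := by
    gcongr
  rw [logWeight, mul_inv, ← mul_assoc]
  refine (mul_le_of_le_one_left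
    (inv_nonneg.2 (Real.rpow_nonneg (log_add_two_pos _).le _)) ?_).trans (inv_anti₀ (by positivity) h5)
  rw [← div_eq_mul_inv, div_le_one (by positivity)]
  push_cast
  linarith

lemma summable_comp_natAbs {f : ℕ → ℝ} (hf : Summable f) :
    Summable fun n : ℤ => f n.natAbs :=
  summable_int_iff_summable_nat_and_neg.2 ⟨by simpa using hf, by simpa using hf⟩

lemma summable_inv_succ_sq : Summable fun n : ℕ => (((n : ℝ) + 1) ^ 2)⁻¹ := by
  have := (summable_nat_add_iff 1).2 (Real.summable_nat_pow_inv.2 one_lt_two)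
  simpa using this

end Summability

/-! ### The measure of small divisors on the circle -/

section Circle

/-- A dyadic majorant of `1 / ‖y‖` on the set where `‖y‖ > 2 ^ (-J)`. -/
noncomputable def dyadicMajorant (J : ℕ) (y : UnitAddCircle) : ℝ≥0∞ :=
  ∑ j ∈ Finset.range J,
    (Metric.closedBall (0 : UnitAddCircle) ((1 / 2) ^ j)).indicator (fun _ => 2 ^ (j + 1)) y

lemma measurable_dyadicMajorant (J : ℕ) : Measurable (dyadicMajorant J) := by
  refine Finset.measurable_fun_sum _ fun j _ => ?_
  exact measurable_const.indicator Metric.isClosed_closedBall.measurableSet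

lemma norm_unitAddCircle_le_half (y : UnitAddCircle) : ‖y‖ ≤ 1 / 2 := by
  simpa using AddCircle.norm_le_half_period 1 one_ne_zero (x := y)

/-- By induction on J, the annulus gained at each step lies in the last ball, whose weight 2^{J+1}
bounds 1/‖y‖ there. At J = 0 the hypothesis is impossible, as ‖y‖ ≤ 1/2. -/
lemma ofReal_inv_norm_le_dyadicMajorant {J : ℕ} {y : UnitAddCircle} (hy : (1 / 2) ^ J < ‖y‖) :
    ENNReal.ofReal ‖y‖⁻¹ ≤ dyadicMajorant J y := by
  induction J with
  | zero =>
    have := norm_unitAddCircle_le_half y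
    rw [pow_zero] at hy
    linarith
  | succ J ih =>
    rw [dyadicMajorant, Finset.sum_range_succ, ← dyadicMajorant]
    rcases lt_or_ge ((1 / 2) ^ J) ‖y‖ with h | h
    · exact (ih h).trans le_self_add
    · refine le_add_of_nonneg_of_le zero_le ?_
      rw [indicator_of_mem (by simpa using h)]
      have h1 : ‖y‖⁻¹ ≤ 2 ^ (J + 1) := by
        rw [one_div, inv_pow] at hy
        exact (inv_le_of_inv_le₀ (by positivity) hy.le)
      refine (ENNReal.ofReal_le_ofReal h1).trans (le_of_eq ?_)
      rw [ENNReal.ofReal_pow two_pos.le, ENNReal.ofReal_ofNat]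

lemma volume_closedBall_unitAddCircle_le (r : ℝ) :
    volume (Metric.closedBall (0 : UnitAddCircle) r) ≤ ENNReal.ofReal (2 * r) := by
  rw [AddCircle.volume_closedBall]
  exact ENNReal.ofReal_le_ofReal (min_le_right _ _)

/-- Each dyadic scale contributes at most 4, since the ball of radius 2^{-j} has measure at most
2·2^{-j}. This is the logarithmic divergence of ∫ 1/‖y‖. -/
lemma lintegral_dyadicMajorant_le (J : ℕ) : ∫⁻ y, dyadicMajorant J y ≤ 4 * J := by
  unfold dyadicMajorant
  rw [lintegral_finsetSum _ fun j _ =>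
    measurable_const.indicator Metric.isClosed_closedBall.measurableSet]
  have h : ∀ j ∈ Finset.range J, ∫⁻ y : UnitAddCircle,
      (Metric.closedBall (0 : UnitAddCircle) ((1 / 2) ^ j)).indicator (fun _ => 2 ^ (j + 1)) y ≤
      4 := fun j _ => by
    rw [lintegral_indicator_const Metric.isClosed_closedBall.measurableSet]
    refine (mul_le_mul_right (volume_closedBall_unitAddCircle_le _) _).trans (le_of_eq ?_)
    have h1 : (2 : ℝ≥0∞) ^ (j + 1) = ENNReal.ofReal (2 ^ (j + 1)) := by
      rw [ENNReal.ofReal_pow two_pos.le, ENNReal.ofReal_ofNat]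
    rw [h1, ← ENNReal.ofReal_mul (by positivity)]
    have h2 : (2 : ℝ) ^ (j + 1) * (2 * (1 / 2) ^ j) = 4 := by
      rw [pow_succ, one_div, inv_pow]
      field_simp
      norm_num
    rw [h2, ENNReal.ofReal_ofNat]
  refine (Finset.sum_le_sum h).trans (le_of_eq ?_)
  rw [Finset.sum_const, Finset.card_range, nsmul_eq_mul, mul_comm]

/-- Jordan's inequality on the circle. -/
lemma four_mul_norm_le_norm_fourier_sub_one (y : UnitAddCircle) :
    4 * ‖y‖ ≤ ‖(fourier 1 y : ℂ) - 1‖ := by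
  obtain ⟨r, rfl, hr⟩ : ∃ r : ℝ, (r : UnitAddCircle) = y ∧ ‖y‖ = |r| := by
    induction y using QuotientAddGroup.induction_on with
    | H r =>
      refine ⟨r - round r, ?_, UnitAddCircle.norm_eq⟩
      rw [AddCircle.coe_sub, sub_eq_self]
      exact (AddCircle.coe_eq_zero_iff 1).2 ⟨round r, by simp⟩
  have hr2 : |r| ≤ 1 / 2 := hr ▸ norm_unitAddCircle_le_half _
  rw [hr, fourier_coe_apply]
  have h1 : 2 * (Real.pi : ℂ) * Complex.I * ((1 : ℤ) : ℂ) * (r : ℂ) / ((1 : ℝ) : ℂ) =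
      Complex.I * ((2 * Real.pi * r : ℝ) : ℂ) := by
    push_cast
    ring
  rw [h1, Complex.norm_exp_I_mul_ofReal_sub_one, norm_mul, Real.norm_eq_abs, Real.norm_eq_abs]
  have h2 : 2 * Real.pi * r / 2 = Real.pi * r := by ring
  have h3 := Real.mul_abs_le_abs_sin (x := Real.pi * r) (by
    rw [abs_mul, abs_of_pos Real.pi_pos]
    have := Real.pi_pos
    nlinarith)
  rw [abs_mul, abs_of_pos Real.pi_pos] at h3
  rw [h2, abs_two]
  have h4 : 2 / Real.pi * (Real.pi * |r|) = 2 * |r| := by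
    have := Real.pi_pos.ne'
    field_simp
  linarith

lemma norm_sum_Icc_pow_le {z : ℂ} (hz : ‖z‖ = 1) (hz1 : z ≠ 1) (m : ℕ) :
    ‖∑ j ∈ Finset.Icc 1 m, z ^ j‖ ≤ 2 / ‖z - 1‖ := by
  have h : ∑ j ∈ Finset.Icc 1 m, z ^ j = z * ((z ^ m - 1) / (z - 1)) := by
    rw [← geom_sum_eq hz1, Finset.mul_sum, Finset.range_eq_Ico, Finset.sum_Ico_eq_sum_range,
      ← Finset.Ico_add_one_right_eq_Icc, Finset.sum_Ico_eq_sum_range]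
    refine Finset.sum_congr (by simp) fun j _ => ?_
    rw [zero_add, pow_add, pow_one]
  rw [h, norm_mul, hz, one_mul, norm_div]
  have h2 : ‖z ^ m - 1‖ ≤ 2 := by
    refine (norm_sub_le _ _).trans ?_
    rw [norm_pow, hz, one_pow, norm_one]
    norm_num
  gcongr

end Circle

/-! ### Small divisors k·x for almost every x -/

section SmallDivisors

variable {d : ℕ}

/-- The linear form `k · x` on the torus. -/
noncomputable def torusForm (k : Fin d → ℤ) : UnitAddTorus (Fin d) →+ UnitAddCircle where
  toFun x := ∑ i, k i • x i
  map_zero' := by simp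
  map_add' x y := by simp [Finset.sum_add_distrib]

lemma torusForm_apply (k : Fin d → ℤ) (x : UnitAddTorus (Fin d)) :
    torusForm k x = ∑ i, k i • x i := rfl

lemma continuous_torusForm (k : Fin d → ℤ) : Continuous (torusForm k) := by
  change Continuous fun x : UnitAddTorus (Fin d) => ∑ i, k i • x i
  fun_prop

lemma torusForm_surjective {k : Fin d → ℤ} (hk : k ≠ 0) : Function.Surjective (torusForm k) := by
  classical
  obtain ⟨i, hi⟩ := Function.ne_iff.1 hk
  intro y
  induction y using QuotientAddGroup.induction_on with
  | H r =>
    refine ⟨Pi.single i ((r / k i : ℝ) : UnitAddCircle), ?_⟩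
    rw [torusForm_apply, Finset.sum_eq_single i]
    · have hi' : (k i : ℝ) ≠ 0 := Int.cast_ne_zero.2 hi
      rw [Pi.single_eq_same, ← AddCircle.coe_zsmul, zsmul_eq_mul, mul_div_cancel₀ _ hi']
    · intro j _ hj
      rw [Pi.single_eq_of_ne hj, smul_zero]
    · simp

/-- A continuous surjective homomorphism of compact groups carries Haar measure to Haar measure of
the same total mass. So k·x is uniformly distributed for every nonzero k, which reduces the metric
estimates to the circle. -/
lemma measurePreserving_torusForm {k : Fin d → ℤ} (hk : k ≠ 0) :
    MeasurePreserving (torusForm k) volume volume :=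
  AddMonoidHom.measurePreserving (continuous_torusForm k) (torusForm_surjective hk) (by simp)

lemma mFourier_eq_fourier_torusForm (k : Fin d → ℤ) (x : UnitAddTorus (Fin d)) :
    UnitAddTorus.mFourier k x = fourier 1 (torusForm k x) := by
  have h : ∀ s : Finset (Fin d), ∏ i ∈ s, fourier (k i) (x i) =
      (fourier 1 (∑ i ∈ s, k i • x i) : ℂ) := fun s => by
    classical
    induction s using Finset.induction_on with
    | empty => simp
    | insert a s ha ih =>
      rw [Finset.prod_insert ha, Finset.sum_insert ha, ih]
      simp [fourier_apply, AddCircle.toCircle_add]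
  exact h Finset.univ

lemma norm_expSum_le {k : Fin d → ℤ} {x : UnitAddTorus (Fin d)} (h : torusForm k x ≠ 0) (m : ℕ) :
    ‖expSum x m k‖ ≤ (m : ℝ)⁻¹ * ‖torusForm k x‖⁻¹ := by
  have hpos : 0 < ‖torusForm k x‖ := norm_pos_iff.2 h
  have h4 := four_mul_norm_le_norm_fourier_sub_one (torusForm k x)
  rw [← mFourier_eq_fourier_torusForm] at h4
  have hpow : ∀ j : ℕ, UnitAddTorus.mFourier k (j • x) = UnitAddTorus.mFourier k x ^ j := fun j => by
    induction j with
    | zero => simp [mFourier_eq_fourier_torusForm]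
    | succ j ih => rw [succ_nsmul, mFourier_add_apply, ih, pow_succ]
  rw [expSum, norm_mul, norm_inv, Complex.norm_natCast]
  refine mul_le_mul_of_nonneg_left ?_ (by positivity)
  simp_rw [hpow]
  refine (norm_sum_Icc_pow_le (norm_mFourier_apply k x) (fun h1 => ?_) m).trans ?_
  · rw [h1, sub_self, norm_zero] at h4
    linarith
  · rw [div_le_iff₀ (by linarith), inv_mul_eq_div, le_div_iff₀ hpos]
    linarith

/-- The size `2 + ∑ |kᵢ|` of a frequency. -/
def freqSize (k : Fin d → ℤ) : ℕ := 2 + ∑ i, (k i).natAbs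

lemma natAbs_add_two_le_freqSize (k : Fin d → ℤ) (i : Fin d) :
    (k i).natAbs + 2 ≤ freqSize k := by
  rw [freqSize, add_comm 2]
  exact Nat.add_le_add_right
    (Finset.single_le_sum (f := fun i => (k i).natAbs) (fun _ _ => Nat.zero_le _)
      (Finset.mem_univ i)) 2

lemma log_freqSize_pos (k : Fin d → ℤ) : 0 < Real.log (freqSize k) := by
  refine Real.log_pos ?_
  have : 2 ≤ freqSize k := Nat.le_add_right _ _
  exact_mod_cast this

/-- The dyadic level below which the divisor `k · x` counts as exceptionally small. -/
def freqLevel (k : Fin d → ℤ) : ℕ := 2 * d * (Nat.log 2 (freqSize k) + 1)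

/-- The factor 2d in the level provides a square for each of the d coordinates, which makes the
measures of the exceptional sets summable over the lattice. -/
lemma half_pow_freqLevel_le (k : Fin d → ℤ) :
    (1 / 2 : ℝ) ^ freqLevel k ≤ ∏ i, ((((k i).natAbs : ℝ) + 1) ^ 2)⁻¹ := by
  have h1 : ∀ i, (((k i).natAbs : ℝ) + 1) ≤ 2 ^ (Nat.log 2 (freqSize k) + 1) := fun i => by
    have h2 := Nat.lt_pow_succ_log_self one_lt_two (freqSize k)
    have h3 := natAbs_add_two_le_freqSize k i
    have h4 : (k i).natAbs + 1 ≤ 2 ^ (Nat.log 2 (freqSize k) + 1) := by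
      rw [← Nat.succ_eq_add_one (Nat.log 2 (freqSize k))]
      omega
    exact_mod_cast h4
  rw [one_div, inv_pow, Finset.prod_inv_distrib]
  refine inv_anti₀ (by positivity) ?_
  calc ∏ i, (((k i).natAbs : ℝ) + 1) ^ 2
      ≤ ∏ _i : Fin d, ((2 : ℝ) ^ (Nat.log 2 (freqSize k) + 1)) ^ 2 :=
        Finset.prod_le_prod (fun i _ => by positivity) fun i _ => by
          have := h1 i
          gcongr
    _ = 2 ^ freqLevel k := by
        rw [Finset.prod_const, Finset.card_univ, Fintype.card_fin, ← pow_mul, ← pow_mul, freqLevel]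
        congr 1
        ring

lemma freqLevel_le (k : Fin d → ℤ) :
    (freqLevel k : ℝ) ≤ 4 * d / Real.log 2 * Real.log (freqSize k) := by
  have hl2 : 0 < Real.log 2 := Real.log_pos one_lt_two
  have h1 : (Nat.log 2 (freqSize k) : ℝ) ≤ Real.log (freqSize k) / Real.log 2 := by
    have := Real.natLog_le_logb (freqSize k) 2
    rwa [Real.logb, Nat.cast_ofNat] at this
  have h2 : 1 ≤ Real.log (freqSize k) / Real.log 2 := by
    rw [one_le_div hl2]
    refine Real.log_le_log two_pos ?_
    have : 2 ≤ freqSize k := Nat.le_add_right _ _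
    exact_mod_cast this
  have h3 : (freqLevel k : ℝ) = 2 * d * ((Nat.log 2 (freqSize k) : ℝ) + 1) := by
    simp [freqLevel]
  rw [h3]
  calc 2 * (d : ℝ) * ((Nat.log 2 (freqSize k) : ℝ) + 1)
      ≤ 2 * d * (Real.log (freqSize k) / Real.log 2 + Real.log (freqSize k) / Real.log 2) := by
        gcongr
    _ = _ := by ring

/-- The weight with which the reciprocals of the divisors `k · x` are summed. -/
noncomputable def freqWeight (δ : ℝ) (k : Fin d → ℤ) : ℝ :=
  (∏ i, logWeight δ (k i).natAbs) / Real.log (freqSize k)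

lemma freqWeight_pos (δ : ℝ) (k : Fin d → ℤ) : 0 < freqWeight δ k :=
  div_pos (Finset.prod_pos fun _ _ => logWeight_pos δ _) (log_freqSize_pos k)

/-- The level grows like the logarithm of the size of k, which is exactly what the denominator of
the weight cancels; a product of summable one-dimensional weights remains. -/
lemma summable_freqWeight_mul_freqLevel {δ : ℝ} (hδ : 0 < δ) :
    Summable fun k : Fin d → ℤ => freqWeight δ k * freqLevel k := by
  have h := (summable_prod_pi (ι := Fin d) (fun n : ℤ => (logWeight_pos δ n.natAbs).le)
    (summable_comp_natAbs (summable_logWeight hδ))).mul_left (4 * d / Real.log 2)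
  refine Summable.of_nonneg_of_le
    (fun k => mul_nonneg (freqWeight_pos δ k).le (Nat.cast_nonneg _)) (fun k => ?_) h
  have h1 := log_freqSize_pos k
  refine (mul_le_mul_of_nonneg_left (freqLevel_le k) (freqWeight_pos δ k).le).trans (le_of_eq ?_)
  rw [freqWeight]
  field_simp

lemma ae_torusForm_ne_zero : ∀ᵐ x : UnitAddTorus (Fin d), ∀ k : Fin d → ℤ, k ≠ 0 →
    torusForm k x ≠ 0 := by
  rw [ae_all_iff]
  intro k
  by_cases hk : k = 0
  · simp [hk]
  · have h0 : volume ({0} : Set UnitAddCircle) = 0 := by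
      have := volume_closedBall_unitAddCircle_le 0
      simpa using this
    have h1 := (measurePreserving_torusForm hk).quasiMeasurePreserving.preimage_null h0
    filter_upwards [measure_eq_zero_iff_ae_notMem.1 h1] with x hx _
    simpa using hx

/-- Borel–Cantelli, the k-th event having measure at most 2·2^{-level}. -/
lemma ae_finite_small_divisors : ∀ᵐ x : UnitAddTorus (Fin d),
    {k : Fin d → ℤ | k ≠ 0 ∧ ‖torusForm k x‖ ≤ (1 / 2) ^ freqLevel k}.Finite := by
  classical
  have h1 : Summable fun k : Fin d → ℤ => 2 * (1 / 2 : ℝ) ^ freqLevel k :=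
    (Summable.of_nonneg_of_le (fun k => by positivity) half_pow_freqLevel_le
      (summable_prod_pi (f := fun n : ℤ => (((n.natAbs : ℝ) + 1) ^ 2)⁻¹) (fun n => by positivity)
        (summable_comp_natAbs summable_inv_succ_sq))).mul_left 2
  let s : (Fin d → ℤ) → Set (UnitAddTorus (Fin d)) := fun k =>
    {x | k ≠ 0 ∧ ‖torusForm k x‖ ≤ (1 / 2) ^ freqLevel k}
  have h2 : ∑' k, volume (s k) ≠ ⊤ := by
    refine ne_top_of_le_ne_top h1.tsum_ofReal_ne_top (ENNReal.tsum_le_tsum fun k => ?_)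
    by_cases hk : k = 0
    · simp [s, hk]
    · have h3 : s k = torusForm k ⁻¹' Metric.closedBall 0 ((1 / 2) ^ freqLevel k) := by
        ext x
        simp [s, hk]
      rw [h3, (measurePreserving_torusForm hk).measure_preimage
        Metric.isClosed_closedBall.measurableSet.nullMeasurableSet]
      exact volume_closedBall_unitAddCircle_le _
  exact ae_finite_setOfPred_mem h2

/-- By Tonelli the sum has finite integral: each term integrates to at most 4 times weight times
level. -/
lemma ae_tsum_dyadicMajorant_lt_top {δ : ℝ} (hδ : 0 < δ) : ∀ᵐ x : UnitAddTorus (Fin d),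
    ∑' k : {k : Fin d → ℤ // k ≠ 0}, ENNReal.ofReal (freqWeight δ k.1) *
      dyadicMajorant (freqLevel k.1) (torusForm k.1 x) < ⊤ := by
  have hmeas : ∀ k : {k : Fin d → ℤ // k ≠ 0}, Measurable fun x : UnitAddTorus (Fin d) =>
      ENNReal.ofReal (freqWeight δ k.1) * dyadicMajorant (freqLevel k.1) (torusForm k.1 x) :=
    fun k => ((measurable_dyadicMajorant _).comp (continuous_torusForm k.1).measurable).const_mul _
  refine ae_lt_top (Measurable.tsum hmeas) ?_
  rw [lintegral_tsum fun k => (hmeas k).aemeasurable]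
  have h1 : Summable fun k : {k : Fin d → ℤ // k ≠ 0} =>
      4 * (freqWeight δ k.1 * freqLevel k.1) :=
    ((summable_freqWeight_mul_freqLevel hδ).subtype _).mul_left 4
  refine ne_top_of_le_ne_top h1.tsum_ofReal_ne_top (ENNReal.tsum_le_tsum fun k => ?_)
  have hm : Measurable fun x => dyadicMajorant (freqLevel k.1) (torusForm k.1 x) :=
    (measurable_dyadicMajorant _).comp (continuous_torusForm k.1).measurable
  rw [lintegral_const_mul _ hm,
    (measurePreserving_torusForm k.2).lintegral_comp (measurable_dyadicMajorant _)]
  refine (mul_le_mul_right (lintegral_dyadicMajorant_le _) _).trans (le_of_eq ?_)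
  rw [mul_left_comm, ENNReal.ofReal_mul (by norm_num), ENNReal.ofReal_mul (freqWeight_pos δ _).le,
    ENNReal.ofReal_natCast, ENNReal.ofReal_ofNat]

/-- The dyadic majorant dominates all but finitely many terms, and those few do not affect
convergence. -/
lemma ae_summable_freqWeight_mul_inv {δ : ℝ} (hδ : 0 < δ) : ∀ᵐ x : UnitAddTorus (Fin d),
    Summable fun k : {k : Fin d → ℤ // k ≠ 0} => freqWeight δ k.1 * ‖torusForm k.1 x‖⁻¹ := by
  filter_upwards [ae_finite_small_divisors, ae_tsum_dyadicMajorant_lt_top (d := d) hδ]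
    with x hfin hsum
  refine Summable.of_norm_bounded_eventually (ENNReal.summable_toReal hsum.ne) ?_
  have hfin' : {k : {k : Fin d → ℤ // k ≠ 0} |
      ‖torusForm k.1 x‖ ≤ (1 / 2) ^ freqLevel k.1}.Finite := by
    refine Set.Finite.of_finite_image (hfin.subset ?_) Subtype.val_injective.injOn
    rintro _ ⟨k, hk, rfl⟩
    exact ⟨k.2, hk⟩
  filter_upwards [hfin'.compl_mem_cofinite] with k hk
  have hk' : (1 / 2) ^ freqLevel k.1 < ‖torusForm k.1 x‖ := not_le.1 hk
  have h0 : 0 ≤ freqWeight δ k.1 * ‖torusForm k.1 x‖⁻¹ :=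
    mul_nonneg (freqWeight_pos δ _).le (by positivity)
  rw [Real.norm_of_nonneg h0]
  refine (ENNReal.ofReal_le_iff_le_toReal (ENNReal.ne_top_of_tsum_ne_top hsum.ne k)).1 ?_
  rw [ENNReal.ofReal_mul (freqWeight_pos δ _).le]
  exact mul_le_mul_right (ofReal_inv_norm_le_dyadicMajorant hk') _

end SmallDivisors

/-! ### Weighted exponential sums for almost every x -/

section AlmostEverywhere

variable {d : ℕ}

lemma one_le_freqNorm {k : Fin d → ℤ} (hk : k ≠ 0) : 1 ≤ freqNorm k := by
  obtain ⟨i, hi⟩ := Function.ne_iff.1 hk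
  refine le_trans ?_ (abs_le_freqNorm k i)
  exact_mod_cast Int.one_le_abs hi

lemma freqSize_le (k : Fin d → ℤ) : (freqSize k : ℝ) ≤ 2 + d * freqNorm k := by
  rw [freqSize]
  push_cast
  have h : ∑ i, ((k i).natAbs : ℝ) ≤ ∑ _i : Fin d, freqNorm k :=
    Finset.sum_le_sum fun i _ => by
      rw [Nat.cast_natAbs, Int.cast_abs]
      exact abs_le_freqNorm k i
  simp only [Finset.sum_const, Finset.card_univ, Fintype.card_fin, nsmul_eq_mul] at h
  linarith

/-- Write N^{-α} = N^{d-α} N^{-d} with N = |k|. As α ≤ d, the first factor is at most R^{d-α}. The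
second is compared with the weight by |kᵢ| + 1 ≤ 2N, the source of 2^d, and by bounding every
logarithm by that of 2 + dR: d powers 1 + δ and one further logarithm make up d + 1 + ε. -/
lemma freqNorm_rpow_neg_le {δ ε : ℝ} (hε : (d : ℝ) * δ = ε) (hδ : 0 < δ) {α : ℝ}
    (hα : α ≤ d) {R : ℝ} {k : Fin d → ℤ} (hk : k ≠ 0) (hkR : freqNorm k < R) :
    freqNorm k ^ (-α) ≤ 2 ^ d * (R ^ ((d : ℝ) - α) * Real.log (2 + d * R) ^ ((d : ℝ) + 1 + ε)) *
      freqWeight δ k := by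
  set N := freqNorm k with hN
  have hN1 : 1 ≤ N := one_le_freqNorm hk
  have hN0 : 0 < N := one_pos.trans_le hN1
  have hR0 : 0 < R := hN0.trans hkR
  set ℓ := Real.log (2 + d * R) with hℓ
  have hsize : (freqSize k : ℝ) ≤ 2 + d * R := by
    refine (freqSize_le k).trans ?_
    gcongr
  have hlog : Real.log (freqSize k) ≤ ℓ := by
    refine Real.log_le_log ?_ hsize
    have : 2 ≤ freqSize k := Nat.le_add_right _ _
    exact_mod_cast (two_pos.trans_le this)
  have hℓ0 : 0 < ℓ := (log_freqSize_pos k).trans_le hlog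
  have h1 : ∀ i, (2 * N * ℓ ^ (1 + δ))⁻¹ ≤ logWeight δ (k i).natAbs := fun i => by
    have h2 : ((k i).natAbs : ℝ) + 1 ≤ 2 * N := by
      have := abs_le_freqNorm k i
      rw [Nat.cast_natAbs, Int.cast_abs]
      linarith
    have h3 := log_add_two_pos (k i).natAbs
    have h4 : Real.log (((k i).natAbs : ℝ) + 2) ≤ ℓ := by
      refine (Real.log_le_log (by positivity) ?_).trans hlog
      exact_mod_cast natAbs_add_two_le_freqSize k i
    unfold logWeight
    gcongr
  have h5 : ((2 * N * ℓ ^ (1 + δ))⁻¹) ^ d / ℓ ≤ freqWeight δ k := by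
    have h6 : ((2 * N * ℓ ^ (1 + δ))⁻¹) ^ d ≤ ∏ i, logWeight δ (k i).natAbs := by
      calc ((2 * N * ℓ ^ (1 + δ))⁻¹) ^ d = ∏ _i : Fin d, (2 * N * ℓ ^ (1 + δ))⁻¹ := by simp
        _ ≤ _ := Finset.prod_le_prod (fun i _ => by positivity) fun i _ => h1 i
    exact div_le_div₀ (Finset.prod_nonneg fun i _ => (logWeight_pos δ _).le) h6
      (log_freqSize_pos k) hlog
  have h7 : N ^ ((d : ℝ) - α) ≤ R ^ ((d : ℝ) - α) :=
    Real.rpow_le_rpow hN0.le hkR.le (by linarith)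
  have h8 : ℓ ^ ((d : ℝ) + 1 + ε) = (ℓ ^ (1 + δ)) ^ d * ℓ := by
    rw [← Real.rpow_natCast (ℓ ^ (1 + δ)), ← Real.rpow_mul hℓ0.le, ← Real.rpow_add_one hℓ0.ne']
    congr 1
    rw [← hε]
    ring
  have h9 : N ^ (-α) = N ^ ((d : ℝ) - α) * (N ^ d)⁻¹ := by
    rw [← Real.rpow_natCast N d, ← Real.rpow_neg hN0.le, ← Real.rpow_add hN0]
    congr 1
    ring
  calc N ^ (-α) = 2 ^ d * (N ^ ((d : ℝ) - α) * ℓ ^ ((d : ℝ) + 1 + ε)) *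
        (((2 * N * ℓ ^ (1 + δ))⁻¹) ^ d / ℓ) := by
        have : 0 < ℓ ^ (1 + δ) := Real.rpow_pos_of_pos hℓ0 _
        rw [h9, h8, inv_pow, mul_pow, mul_pow]
        field_simp
    _ ≤ _ := by gcongr

/-- For almost every `x` the weighted exponential sums along the multiples of `x` are small. -/
lemma ae_sum_freqNorm_mul_expSum_le (hd : 0 < d) {ε : ℝ} (hε : 0 < ε) :
    ∀ᵐ x : UnitAddTorus (Fin d), ∃ C : ℝ, 0 ≤ C ∧ ∀ α : ℝ, α ≤ d → ∀ R : ℝ, 0 < R → ∀ m : ℕ,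
      ∑ k ∈ (freqBall d R).erase 0, freqNorm k ^ (-α) * ‖expSum x m k‖ ≤
        C * ((m : ℝ)⁻¹ * (R ^ ((d : ℝ) - α) * Real.log (2 + d * R) ^ ((d : ℝ) + 1 + ε))) := by
  have hd' : (0 : ℝ) < d := Nat.cast_pos.2 hd
  have hδ : 0 < ε / d := div_pos hε hd'
  filter_upwards [ae_torusForm_ne_zero (d := d), ae_summable_freqWeight_mul_inv (d := d) hδ]
    with x hne hsum
  have hnn : ∀ k : {k : Fin d → ℤ // k ≠ 0},
      0 ≤ freqWeight (ε / d) k.1 * ‖torusForm k.1 x‖⁻¹ := fun k =>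
    mul_nonneg (freqWeight_pos _ _).le (by positivity)
  -- The constant is fixed before α, R and m, which gives uniformity in all three.
  refine ⟨2 ^ d * ∑' k : {k : Fin d → ℤ // k ≠ 0}, freqWeight (ε / d) k.1 * ‖torusForm k.1 x‖⁻¹,
    mul_nonneg (by positivity) (tsum_nonneg hnn), fun α hα R hR m => ?_⟩
  have hlog : 0 ≤ Real.log (2 + d * R) := Real.log_nonneg (by nlinarith)
  set D : ℝ := R ^ ((d : ℝ) - α) * Real.log (2 + d * R) ^ ((d : ℝ) + 1 + ε) with hD
  have hD0 : 0 ≤ D := by positivity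
  have hterm : ∀ k ∈ (freqBall d R).erase 0, freqNorm k ^ (-α) * ‖expSum x m k‖ ≤
      2 ^ d * ((m : ℝ)⁻¹ * D) * (freqWeight (ε / d) k * ‖torusForm k x‖⁻¹) := fun k hk => by
    obtain ⟨hk0, hkR⟩ := Finset.mem_erase.1 hk
    have h1 := freqNorm_rpow_neg_le (mul_div_cancel₀ ε hd'.ne') hδ hα hk0 (mem_freqBall.1 hkR)
    have h2 := norm_expSum_le (hne k hk0) m
    refine (mul_le_mul h1 h2 (norm_nonneg _) ?_).trans (le_of_eq ?_)
    · exact mul_nonneg (by positivity) (freqWeight_pos _ _).le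
    · ring
  refine (Finset.sum_le_sum hterm).trans ?_
  rw [← Finset.mul_sum]
  have hsub : ∑ k ∈ (freqBall d R).erase 0, freqWeight (ε / d) k * ‖torusForm k x‖⁻¹ ≤
      ∑' k : {k : Fin d → ℤ // k ≠ 0}, freqWeight (ε / d) k.1 * ‖torusForm k.1 x‖⁻¹ := by
    have h3 := hsum.sum_le_tsum (((freqBall d R).erase 0).subtype fun k => k ≠ 0)
      fun k _ => hnn k
    rwa [Finset.sum_subtype_of_mem (fun k => freqWeight (ε / d) k * ‖torusForm k x‖⁻¹)
      fun k hk => (Finset.mem_erase.1 hk).1] at h3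
  calc _ ≤ 2 ^ d * ((m : ℝ)⁻¹ * D) * _ := mul_le_mul_of_nonneg_left hsub (by positivity)
    _ = _ := by ring

end AlmostEverywhere

/-! ### Choice of the cut-off R -/

section Parameters

/-- The choice of the cut-off frequency. -/
lemma exists_log_cutoff_le (d : ℕ) {L η : ℝ} (hL : 0 ≤ L) (hη : 0 < η) : ∃ C : ℝ, 0 ≤ C ∧
    ∀ θ : ℝ, η ≤ θ → ∀ m : ℕ, 1 < m →
      Real.log (2 + d * (m / Real.log m ^ L) ^ (1 / θ)) ≤ C * Real.log m := by
  have hl2 : 0 < Real.log 2 := Real.log_pos one_lt_two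
  -- A bounds 1/log^L m, since log m ≥ log 2. The maximum with 1 ensures mA ≥ 1, so that the
  -- exponent 1/θ may be raised to 1/η.
  set A : ℝ := max 1 (Real.log 2 ^ L)⁻¹ with hA
  have hA1 : 1 ≤ A := le_max_left _ _
  have hlA : 0 ≤ Real.log A := Real.log_nonneg hA1
  have hld : 0 ≤ Real.log (2 + d) := Real.log_nonneg (by linarith [d.cast_nonneg (α := ℝ)])
  refine ⟨(Real.log (2 + d) + Real.log A / η) / Real.log 2 + 1 / η, by positivity,
    fun θ hθ m hm => ?_⟩
  have hm2 : (2 : ℝ) ≤ m := by exact_mod_cast hm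
  have hlm : Real.log 2 ≤ Real.log m := Real.log_le_log two_pos hm2
  have hlm0 : 0 < Real.log m := hl2.trans_le hlm
  have h1 : (m : ℝ) / Real.log m ^ L ≤ m * A := by
    rw [div_eq_mul_inv]
    refine mul_le_mul_of_nonneg_left (le_trans ?_ (le_max_right _ _)) (by positivity)
    gcongr
  have hmA : 1 ≤ (m : ℝ) * A := by nlinarith
  have h2 : ((m : ℝ) / Real.log m ^ L) ^ (1 / θ) ≤ (m * A) ^ (1 / η) := by
    have hθ0 : 0 < θ := hη.trans_le hθ
    calc ((m : ℝ) / Real.log m ^ L) ^ (1 / θ) ≤ (m * A) ^ (1 / θ) :=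
          Real.rpow_le_rpow (by positivity) h1 (by positivity)
      _ ≤ _ := Real.rpow_le_rpow_of_exponent_le hmA (one_div_le_one_div_of_le hη hθ)
  have h3 : 1 ≤ ((m : ℝ) * A) ^ (1 / η) := Real.one_le_rpow hmA (by positivity)
  have h4 : 2 + d * ((m : ℝ) / Real.log m ^ L) ^ (1 / θ) ≤ (2 + d) * (m * A) ^ (1 / η) := by
    have h5 := mul_le_mul_of_nonneg_left h2 (d.cast_nonneg (α := ℝ))
    linarith
  have h6 : 0 ≤ ((m : ℝ) / Real.log m ^ L) ^ (1 / θ) := by positivity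
  refine (Real.log_le_log (by positivity) h4).trans ?_
  rw [Real.log_mul (by positivity) (by positivity), Real.log_rpow (by positivity),
    Real.log_mul (by positivity) (by positivity)]
  have h7 : Real.log (2 + d) + Real.log A / η ≤
      (Real.log (2 + d) + Real.log A / η) / Real.log 2 * Real.log m := by
    rw [div_mul_eq_mul_div, le_div_iff₀ hl2]
    exact mul_le_mul_of_nonneg_left hlm (by positivity)
  calc Real.log (2 + d) + 1 / η * (Real.log m + Real.log A)
      = (Real.log (2 + d) + Real.log A / η) + 1 / η * Real.log m := by ring
    _ ≤ _ := by rw [add_mul]; gcongr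

lemma cutoff_rpow_neg {M ℓ L θ : ℝ} (β : ℝ) (hM : 0 < M) (hℓ : 0 < ℓ) :
    ((M / ℓ ^ L) ^ (1 / θ)) ^ (-β) = M ^ (-β / θ) * ℓ ^ (β * L / θ) := by
  rw [← Real.rpow_mul (by positivity), Real.div_rpow hM.le (by positivity), ← Real.rpow_mul hℓ.le,
    div_eq_mul_inv, ← Real.rpow_neg hℓ.le]
  congr 2 <;> ring

/-- R is defined by R^{γ+β} = M/ℓ^L. With γ = d - α this equates the exponential-sum term, its
logarithms taken as ℓ^L, with the smoothing error R^{-β}. -/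
lemma cutoff_balance {M ℓ L γ β : ℝ} (hM : 0 < M) (hℓ : 0 < ℓ) (hθ : 0 < γ + β) :
    M⁻¹ * ((M / ℓ ^ L) ^ (1 / (γ + β))) ^ γ =
      ((M / ℓ ^ L) ^ (1 / (γ + β))) ^ (-β) * (ℓ ^ L)⁻¹ := by
  set R := (M / ℓ ^ L) ^ (1 / (γ + β)) with hR
  have hR0 : 0 < R := by positivity
  have h1 : R ^ (γ + β) = M / ℓ ^ L := by
    rw [hR, ← Real.rpow_mul (by positivity), one_div, inv_mul_cancel₀ hθ.ne', Real.rpow_one]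
  have h2 : R ^ γ = R ^ (-β) * (M / ℓ ^ L) := by
    rw [← h1, ← Real.rpow_add hR0]
    congr 1
    ring
  rw [h2]
  field_simp

end Parameters

/-! ### The discrepancy bound from a Fourier bound -/

section Discrepancy

variable {d : ℕ} {φ : EuclideanSpace ℝ (Fin d) → ℝ}

lemma norm_le_of_enorm_le_ofReal {E : Type*} [NormedAddCommGroup E] {v : E} {a : ℝ} (ha : 0 ≤ a)
    (h : ‖v‖ₑ ≤ ENNReal.ofReal a) : ‖v‖ ≤ a := by
  rw [← ofReal_norm] at h
  exact (ENNReal.ofReal_le_ofReal_iff ha).1 h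

lemma discrepancy_le_of_isFourierBound (hφ : IsProfile φ) (hd : 0 < d)
    {Ω : Set (UnitAddTorus (Fin d))} (hΩ : NullMeasurableSet Ω) {α β F : ℝ} (hF : 0 ≤ F)
    (h : IsFourierBound φ α β Ω (ENNReal.ofReal F)) {R : ℝ} (hR : 0 < R)
    (x : UnitAddTorus (Fin d)) {m : ℕ} (hm : 0 < m) :
    discrepancy x m Ω ≤ F * (R ^ (-β) +
      2 * ∑ k ∈ (freqBall d R).erase 0, freqNorm k ^ (-α) * ‖expSum x m k‖) := by
  have hN : ∀ k : Fin d → ℤ, 0 ≤ freqNorm k := fun k => Real.sqrt_nonneg _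
  refine (discrepancy_le hφ hd hΩ hR x hm).trans ?_
  rw [mul_add, ← mul_assoc, Finset.mul_sum]
  refine add_le_add ?_ (Finset.sum_le_sum fun k hk => ?_)
  · refine norm_le_of_enorm_le_ofReal (by positivity) ?_
    rw [ENNReal.ofReal_mul hF]
    exact h.boundary_zero_le R hR
  · obtain ⟨hk0, hkR⟩ := Finset.mem_erase.1 hk
    have hp := Real.rpow_nonneg (hN k) (-α)
    have h1 : ‖torusCoeff (Ω.indicator fun _ => 1) k‖ ≤ F * freqNorm k ^ (-α) := by
      refine norm_le_of_enorm_le_ofReal (by positivity) ?_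
      rw [ENNReal.ofReal_mul hF]
      exact h.indicator_le k hk0
    have h2 : ‖torusCoeff (boundaryLayer φ R Ω) k‖ ≤ F * freqNorm k ^ (-α) := by
      refine norm_le_of_enorm_le_ofReal (by positivity) ?_
      rw [ENNReal.ofReal_mul hF]
      exact h.boundary_le R hR k hk0 (mem_freqBall.1 hkR)
    calc _ ≤ (F * freqNorm k ^ (-α) + F * freqNorm k ^ (-α)) * ‖expSum x m k‖ := by gcongr
      _ = _ := by ring

/-- For almost every `x`, the discrepancy is controlled by any finite Fourier bound. -/
theorem ae_discrepancy_le (hd : 0 < d) {ε : ℝ} (hε : 0 < ε) :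
    ∀ᵐ x : UnitAddTorus (Fin d), ∀ η : ℝ, 0 < η → ∃ c : ℝ, 0 < c ∧
      ∀ φ : EuclideanSpace ℝ (Fin d) → ℝ, IsProfile φ →
      ∀ α β : ℝ, α ≤ d → η ≤ d + β - α → ∀ m : ℕ, 1 < m →
      ∀ Ω : Set (UnitAddTorus (Fin d)), NullMeasurableSet Ω → ∀ F : ℝ, 0 ≤ F →
        IsFourierBound φ α β Ω (ENNReal.ofReal F) →
        discrepancy x m Ω ≤ c * F * ((m : ℝ) ^ (-β / (d + β - α)) *
          Real.log m ^ (β * (d + 1 + ε) / (d + β - α))) := by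
  filter_upwards [ae_sum_freqNorm_mul_expSum_le hd hε] with x hx η hη
  obtain ⟨C, hC, hx⟩ := hx
  obtain ⟨C', hC', hlog⟩ := exists_log_cutoff_le d (L := (d : ℝ) + 1 + ε) (by positivity) hη
  -- The 1 accounts for the mean of the boundary layer. The 2 counts the coefficients of the
  -- indicator and of the layer, and the power of C' comes from replacing log(2 + dR) by log m.
  refine ⟨1 + 2 * C * C' ^ ((d : ℝ) + 1 + ε), by positivity,
    fun φ hφ α β hα hηθ m hm Ω hΩ F hF hb => ?_⟩
  have hm0 : (0 : ℝ) < m := by exact_mod_cast one_pos.trans hm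
  have hlm : 0 < Real.log m := Real.log_pos (by exact_mod_cast hm)
  set L : ℝ := (d : ℝ) + 1 + ε with hL
  have hL0 : 0 ≤ L := by positivity
  have hθ : (d : ℝ) + β - α = ((d : ℝ) - α) + β := by ring
  have hθ0 : 0 < ((d : ℝ) - α) + β := by linarith
  rw [hθ] at hηθ ⊢
  set R : ℝ := ((m : ℝ) / Real.log m ^ L) ^ (1 / (((d : ℝ) - α) + β)) with hR
  have hR0 : 0 < R := by positivity
  have h1 := discrepancy_le_of_isFourierBound hφ hd hΩ hF hb hR0 x (one_pos.trans hm)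
  have h2 := hx α hα R hR0 m
  have h3 : Real.log (2 + d * R) ^ L ≤ (C' * Real.log m) ^ L :=
    Real.rpow_le_rpow (Real.log_nonneg (by nlinarith [d.cast_nonneg (α := ℝ)]))
      (hlog _ hηθ m hm) hL0
  rw [Real.mul_rpow hC' hlm.le] at h3
  have h4 : (m : ℝ)⁻¹ * (R ^ ((d : ℝ) - α) * Real.log (2 + d * R) ^ L) ≤ C' ^ L * R ^ (-β) := by
    rw [← mul_assoc, cutoff_balance hm0 hlm hθ0]
    have hp : 0 < Real.log m ^ L := by positivity
    calc R ^ (-β) * (Real.log m ^ L)⁻¹ * Real.log (2 + d * R) ^ L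
        ≤ R ^ (-β) * (Real.log m ^ L)⁻¹ * (C' ^ L * Real.log m ^ L) := by gcongr
      _ = _ := by field_simp
  rw [← cutoff_rpow_neg β hm0 hlm, ← hR]
  calc discrepancy x m Ω ≤ F * (R ^ (-β) + 2 * (C * (C' ^ L * R ^ (-β)))) := by
        refine h1.trans ?_
        have := h2.trans (mul_le_mul_of_nonneg_left h4 hC)
        gcongr
    _ = _ := by ring

end Discrepancy

/-! ### Existence of a profile -/

section ProfileExists

/-- Part (b) does not mention φ, so its proof has to supply one: a radial bump function normalized
in L². -/
lemma exists_isProfile (d : ℕ) : ∃ φ : EuclideanSpace ℝ (Fin d) → ℝ, IsProfile φ := by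
  set ψ : EuclideanSpace ℝ (Fin d) → ℝ := fun ξ => expNegInvGlue (1 / 4 - ‖ξ‖ ^ 2) with hψ
  have hsmooth : ContDiff ℝ ∞ ψ :=
    expNegInvGlue.contDiff.comp (contDiff_const.sub (contDiff_norm_sq ℝ))
  have hsupp : ∀ ξ, 1 / 2 ≤ ‖ξ‖ → ψ ξ = 0 := fun ξ hξ =>
    expNegInvGlue.zero_of_nonpos (by nlinarith)
  have hcs : HasCompactSupport fun ξ => ψ ξ ^ 2 :=
    HasCompactSupport.intro (isCompact_closedBall 0 (1 / 2)) fun ξ hξ => by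
      rw [hsupp ξ (by simpa using (not_le.1 (fun h => hξ (by simpa using h))).le)]
      norm_num
  have hpos : 0 < ∫ ξ, ψ ξ ^ 2 := by
    refine (hsmooth.continuous.pow 2).integral_pos_of_hasCompactSupport_nonneg_nonzero hcs
      (fun ξ => sq_nonneg _) (x := 0) ?_
    refine pow_ne_zero 2 (ne_of_gt ?_)
    exact expNegInvGlue.pos_of_pos (by simp)
  refine ⟨fun ξ => (√(∫ ξ, ψ ξ ^ 2))⁻¹ * ψ ξ, contDiff_const.mul hsmooth, fun ξ η h => ?_,
    fun ξ hξ => ?_, ?_⟩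
  · simp only [hψ, h]
  · simp only [hsupp ξ hξ, mul_zero]
  · simp only [mul_pow]
    rw [integral_const_mul, inv_pow, Real.sq_sqrt hpos.le, inv_mul_cancel₀ hpos.ne']

end ProfileExists

/-! ### Fourier bounds from the Minkowski content of the boundary -/

section Minkowski

variable {d : ℕ} {φ : EuclideanSpace ℝ (Fin d) → ℝ} {Ω : Set (UnitAddTorus (Fin d))} {α γ : ℝ}

lemma volume_boundaryDist_lt_le (hγ : 0 ≤ γ) (hM : minkowskiConst α Ω ≤ ENNReal.ofReal γ) {t : ℝ}
    (ht : 0 < t) :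
    volume {x | boundaryDist Ω x < ENNReal.ofReal t} ≤ ENNReal.ofReal (γ * t ^ α) := by
  have h1 : ENNReal.ofReal (t ^ (-α)) * volume {x | boundaryDist Ω x < ENNReal.ofReal t} ≤
      ENNReal.ofReal γ :=
    (le_iSup₂ (f := fun (t : ℝ) (_ : 0 < t) => ENNReal.ofReal (t ^ (-α)) *
      volume {x | boundaryDist Ω x < ENNReal.ofReal t}) t ht).trans hM
  have h2 := mul_le_mul_left h1 (ENNReal.ofReal (t ^ α))
  rw [← ENNReal.ofReal_mul hγ, mul_right_comm, ← ENNReal.ofReal_mul (by positivity),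
    ← Real.rpow_add ht, neg_add_cancel, Real.rpow_zero, ENNReal.ofReal_one, one_mul] at h2
  exact h2

/-- The translation by half a period in the direction of the frequency `k`. -/
noncomputable def halfPeriod (k : Fin d → ℤ) : EuclideanSpace ℝ (Fin d) :=
  (1 / (2 * freqNorm k ^ 2)) • freqVec k

lemma norm_halfPeriod {k : Fin d → ℤ} (hk : k ≠ 0) : ‖halfPeriod k‖ = 1 / (2 * freqNorm k) := by
  have h := one_pos.trans_le (one_le_freqNorm hk)
  rw [halfPeriod, norm_smul, norm_freqVec, Real.norm_of_nonneg (by positivity)]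
  field_simp

lemma mFourier_neg_halfPeriod {k : Fin d → ℤ} (hk : k ≠ 0) :
    UnitAddTorus.mFourier (-k) (toTorus (halfPeriod k)) = -1 := by
  have h := one_pos.trans_le (one_le_freqNorm hk)
  rw [mFourier_neg_toTorus, halfPeriod, real_inner_smul_left, real_inner_self_eq_norm_sq,
    norm_freqVec]
  have h1 : -2 * Real.pi * (1 / (2 * freqNorm k ^ 2) * freqNorm k ^ 2) = -Real.pi := by
    field_simp
  rw [h1, Complex.ofReal_neg, neg_mul, Complex.exp_neg, Complex.exp_pi_mul_I]
  norm_num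

lemma integrable_mul_mFourier {f : UnitAddTorus (Fin d) → ℝ} (hf : Integrable f) (k : Fin d → ℤ) :
    Integrable fun x => (f x : ℂ) * UnitAddTorus.mFourier k x :=
  hf.ofReal.mul_bdd (c := 1) (by fun_prop)
    (Filter.Eventually.of_forall fun x => (norm_mFourier_apply k x).le)

/-- Translation by half a period h negates the coefficient, so twice it is the coefficient of χ -
χ(· - h). As |h| = 1/(2|k|), this difference vanishes unless dist(x, ∂Ω) < 1/|k|, and the measure of
that layer bounds the integral. -/
lemma norm_torusCoeff_indicator_le (hΩ : NullMeasurableSet Ω) (hγ : 0 ≤ γ)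
    (hM : minkowskiConst α Ω ≤ ENNReal.ofReal γ) {k : Fin d → ℤ} (hk : k ≠ 0) :
    ‖torusCoeff (Ω.indicator fun _ => 1) k‖ ≤ γ * freqNorm k ^ (-α) := by
  have hN := one_pos.trans_le (one_le_freqNorm hk)
  set χ : UnitAddTorus (Fin d) → ℝ := Ω.indicator fun _ => 1 with hχ
  set S : Set (UnitAddTorus (Fin d)) := {x | boundaryDist Ω x < ENNReal.ofReal (1 / freqNorm k)}
    with hS
  have hSm : MeasurableSet S := measurableSet_lt (measurable_boundaryDist Ω) measurable_const
  have hi : Integrable χ := (integrable_const (1 : ℝ)).indicator₀ hΩ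
  have hi' : Integrable fun x => χ (x - toTorus (halfPeriod k)) := hi.comp_sub_right _
  have htr := torusCoeff_translate χ k (halfPeriod k)
  rw [mFourier_neg_halfPeriod hk, neg_one_mul] at htr
  have h2 : 2 * torusCoeff χ k = ∫ x, ((χ x : ℂ) * UnitAddTorus.mFourier (-k) x -
      (χ (x - toTorus (halfPeriod k)) : ℂ) * UnitAddTorus.mFourier (-k) x) := by
    rw [integral_sub (integrable_mul_mFourier hi _) (integrable_mul_mFourier hi' _)]
    change _ = torusCoeff χ k - torusCoeff (fun x => χ (x - toTorus (halfPeriod k))) k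
    rw [htr]
    ring
  have h3 : ‖2 * torusCoeff χ k‖ ≤ volume.real S := by
    rw [h2, ← integral_indicator_one hSm]
    refine norm_integral_le_of_norm_le ((integrable_const (1 : ℝ)).indicator hSm)
      (Filter.Eventually.of_forall fun x => ?_)
    rw [← sub_mul, norm_mul, norm_mFourier_apply, mul_one, ← Complex.ofReal_sub,
      Complex.norm_real, Real.norm_eq_abs]
    by_cases hx : x ∈ S
    · rw [indicator_of_mem hx, abs_le, hχ]
      by_cases h1 : x ∈ Ω <;>
        by_cases h2 : x - toTorus (halfPeriod k) ∈ Ω <;> simp [h1, h2]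
    · have hlt : ENNReal.ofReal ‖halfPeriod k‖ < boundaryDist Ω x := by
        refine lt_of_lt_of_le ?_ (not_lt.1 hx)
        rw [norm_halfPeriod hk]
        refine (ENNReal.ofReal_lt_ofReal_iff (by positivity)).2 ?_
        exact one_div_lt_one_div_of_lt hN (by linarith)
      have hmem := sub_toTorus_mem_iff hlt
      have h0 : χ x - χ (x - toTorus (halfPeriod k)) = 0 := by
        rw [hχ]
        by_cases h : x ∈ Ω <;> simp [hmem, h]
      rw [indicator_of_notMem hx, h0, abs_zero]
  have h4 : volume.real S ≤ γ * freqNorm k ^ (-α) := by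
    refine ENNReal.toReal_le_of_le_ofReal (by positivity) ?_
    refine (volume_boundaryDist_lt_le hγ hM (by positivity)).trans (le_of_eq ?_)
    rw [one_div, Real.inv_rpow hN.le, Real.rpow_neg hN.le]
  rw [norm_mul, Complex.norm_ofNat] at h3
  have := norm_nonneg (torusCoeff χ k)
  linarith

/-- The constant in the bound of the mean of the boundary layer. -/
noncomputable def layerConst (φ : EuclideanSpace ℝ (Fin d) → ℝ) : ℝ :=
  psiConst φ * ∫ y, (2 * ‖y‖ + 1) * kernel φ y

lemma integrable_two_mul_norm_add_one_mul_kernel (hφ : IsProfile φ) :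
    Integrable fun y => (2 * ‖y‖ + 1) * kernel φ y := by
  refine (((integrable_norm_pow_mul_kernel hφ 1).const_mul 2).add (integrable_kernel hφ)).congr
    (Filter.Eventually.of_forall fun y => ?_)
  simp only [Pi.add_apply, pow_one]
  ring

lemma layerConst_nonneg (hφ : IsProfile φ) : 0 ≤ layerConst φ :=
  mul_nonneg (psiConst_pos hφ).le (integral_nonneg fun y =>
    mul_nonneg (by positivity) (kernel_nonneg hφ y))

lemma ofReal_kernelTail (hφ : IsProfile φ) (t : ℝ≥0∞) :
    ENNReal.ofReal (kernelTail φ t) =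
      ∫⁻ y, {y : EuclideanSpace ℝ (Fin d) | t ≤ ENNReal.ofReal ‖y‖}.indicator
        (fun y => ENNReal.ofReal (kernel φ y)) y := by
  rw [kernelTail, ofReal_integral_eq_lintegral_ofReal (integrable_kernel hφ).integrableOn
    (Filter.Eventually.of_forall fun y => kernel_nonneg hφ y),
    lintegral_indicator (measurableSet_tail t)]

/-- With the tail written as an integral over y, Tonelli leaves for each y the measure of {R dist ≤
2|y|}. It is at most γ((2|y|+1)/R)^α, the added 1 making the inequality strict and the base at least
1. Then α ≤ 1 gives (2|y|+1)^α ≤ 2|y|+1, and the kernel has a finite first moment. -/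
lemma lintegral_boundaryLayer_le (hφ : IsProfile φ) (hα1 : α ≤ 1) (hγ : 0 ≤ γ)
    (hM : minkowskiConst α Ω ≤ ENNReal.ofReal γ) {R : ℝ} (hR : 0 < R) :
    ∫⁻ x, ENNReal.ofReal (boundaryLayer φ R Ω x) ≤
      ENNReal.ofReal (layerConst φ * γ * R ^ (-α)) := by
  have h1 : ∀ x, ENNReal.ofReal (boundaryLayer φ R Ω x) = ENNReal.ofReal (psiConst φ) *
      ∫⁻ y, {y : EuclideanSpace ℝ (Fin d) |
        ENNReal.ofReal R * boundaryDist Ω x / 2 ≤ ENNReal.ofReal ‖y‖}.indicator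
          (fun y => ENNReal.ofReal (kernel φ y)) y := fun x => by
    rw [boundaryLayer, psi_eq, ENNReal.ofReal_mul (psiConst_pos hφ).le, ofReal_kernelTail hφ]
  have hK : Measurable fun y => ENNReal.ofReal (kernel φ y) :=
    (continuous_kernel hφ).measurable.ennreal_ofReal
  have hset : MeasurableSet {p : UnitAddTorus (Fin d) × EuclideanSpace ℝ (Fin d) |
      ENNReal.ofReal R * boundaryDist Ω p.1 / 2 ≤ ENNReal.ofReal ‖p.2‖} :=
    measurableSet_le ((((measurable_boundaryDist Ω).comp measurable_fst).const_mul _).div_const _)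
      (by fun_prop)
  have h2 : ∀ y : EuclideanSpace ℝ (Fin d), ∫⁻ x, {y : EuclideanSpace ℝ (Fin d) |
        ENNReal.ofReal R * boundaryDist Ω x / 2 ≤ ENNReal.ofReal ‖y‖}.indicator
          (fun y => ENNReal.ofReal (kernel φ y)) y ≤
      ENNReal.ofReal (γ * R ^ (-α) * ((2 * ‖y‖ + 1) * kernel φ y)) := fun y => by
    have h3 : ∀ x, {y : EuclideanSpace ℝ (Fin d) |
        ENNReal.ofReal R * boundaryDist Ω x / 2 ≤ ENNReal.ofReal ‖y‖}.indicator
          (fun y => ENNReal.ofReal (kernel φ y)) y ≤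
        {x | boundaryDist Ω x < ENNReal.ofReal ((2 * ‖y‖ + 1) / R)}.indicator
          (fun _ => ENNReal.ofReal (kernel φ y)) x := fun x => by
      by_cases hx : ENNReal.ofReal R * boundaryDist Ω x / 2 ≤ ENNReal.ofReal ‖y‖
      · have hx' : boundaryDist Ω x < ENNReal.ofReal ((2 * ‖y‖ + 1) / R) := by
          have h4 : ENNReal.ofReal R * boundaryDist Ω x ≤ ENNReal.ofReal (2 * ‖y‖) := by
            rw [mul_comm 2, ENNReal.ofReal_mul (norm_nonneg y), ENNReal.ofReal_ofNat]
            exact (ENNReal.div_le_iff two_ne_zero ENNReal.ofNat_ne_top).1 hx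
          rw [ENNReal.ofReal_div_of_pos hR, ENNReal.lt_div_iff_mul_lt
            (Or.inl (ENNReal.ofReal_pos.2 hR).ne') (Or.inl ENNReal.ofReal_ne_top), mul_comm]
          refine h4.trans_lt ((ENNReal.ofReal_lt_ofReal_iff (by positivity)).2 (by linarith))
        rw [indicator_of_mem (show x ∈ {x | boundaryDist Ω x <
          ENNReal.ofReal ((2 * ‖y‖ + 1) / R)} from hx')]
        exact indicator_le_self _ _ _
      · rw [indicator_of_notMem (by exact hx)]
        exact zero_le
    refine (lintegral_mono h3).trans ?_
    rw [lintegral_indicator_const (measurableSet_lt (measurable_boundaryDist Ω) measurable_const),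
      mul_comm]
    refine (mul_le_mul_left (volume_boundaryDist_lt_le hγ hM (by positivity)) _).trans ?_
    rw [← ENNReal.ofReal_mul (by positivity)]
    refine ENNReal.ofReal_le_ofReal ?_
    rw [← mul_assoc]
    refine mul_le_mul_of_nonneg_right ?_ (kernel_nonneg hφ y)
    rw [mul_assoc]
    refine mul_le_mul_of_nonneg_left ?_ hγ
    rw [Real.div_rpow (by positivity) hR.le, div_eq_inv_mul, ← Real.rpow_neg hR.le]
    refine mul_le_mul_of_nonneg_left ?_ (by positivity)
    have h5 := Real.rpow_le_rpow_of_exponent_le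
      (show 1 ≤ 2 * ‖y‖ + 1 by linarith [norm_nonneg y]) hα1
    rwa [Real.rpow_one] at h5
  simp_rw [h1]
  rw [lintegral_const_mul' _ _ ENNReal.ofReal_ne_top, lintegral_lintegral_swap]
  · refine (mul_le_mul_right (lintegral_mono h2) _).trans (le_of_eq ?_)
    rw [← ofReal_integral_eq_lintegral_ofReal
      ((integrable_two_mul_norm_add_one_mul_kernel hφ).const_mul _)
      (Filter.Eventually.of_forall fun y => mul_nonneg (by positivity)
        (mul_nonneg (by positivity) (kernel_nonneg hφ y))),
      ← ENNReal.ofReal_mul (psiConst_pos hφ).le, integral_const_mul, layerConst]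
    congr 1
    ring
  · exact ((hK.comp measurable_snd).indicator hset).aemeasurable

lemma enorm_torusCoeff_boundaryLayer_le (hφ : IsProfile φ) (hα1 : α ≤ 1) (hγ : 0 ≤ γ)
    (hM : minkowskiConst α Ω ≤ ENNReal.ofReal γ) {R : ℝ} (hR : 0 < R) (k : Fin d → ℤ) :
    ‖torusCoeff (boundaryLayer φ R Ω) k‖ₑ ≤ ENNReal.ofReal (layerConst φ * γ * R ^ (-α)) := by
  refine (enorm_integral_le_lintegral_enorm _).trans
    (le_trans (le_of_eq (lintegral_congr fun x => ?_))
      (lintegral_boundaryLayer_le hφ hα1 hγ hM hR))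
  rw [← ofReal_norm, norm_mul, norm_mFourier_apply, mul_one, Complex.norm_real,
    boundaryLayer, Real.norm_of_nonneg (psi_nonneg hφ _)]

/-- A bound on the Minkowski content of the boundary yields Fourier bounds. -/
lemma isFourierBound_of_minkowskiConst_le (hφ : IsProfile φ) (hΩ : NullMeasurableSet Ω)
    (hα0 : 0 ≤ α) (hα1 : α ≤ 1) (hγ : 0 ≤ γ) (hM : minkowskiConst α Ω ≤ ENNReal.ofReal γ) :
    IsFourierBound φ α α Ω (ENNReal.ofReal ((1 + layerConst φ) * γ)) := by
  have hc := layerConst_nonneg hφ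
  have hcγ : 0 ≤ (1 + layerConst φ) * γ := by positivity
  refine ⟨fun k hk => ?_, fun R hR k hk hkR => ?_, fun R hR => ?_⟩
  · have hN := one_pos.trans_le (one_le_freqNorm hk)
    rw [← ofReal_norm, ← ENNReal.ofReal_mul hcγ]
    refine ENNReal.ofReal_le_ofReal ((norm_torusCoeff_indicator_le hΩ hγ hM hk).trans ?_)
    refine mul_le_mul_of_nonneg_right ?_ (by positivity)
    nlinarith
  · have hN := one_pos.trans_le (one_le_freqNorm hk)
    refine (enorm_torusCoeff_boundaryLayer_le hφ hα1 hγ hM hR k).trans ?_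
    rw [← ENNReal.ofReal_mul hcγ]
    refine ENNReal.ofReal_le_ofReal (mul_le_mul ?_ ?_ (by positivity) hcγ)
    · nlinarith
    -- Since |k| < R, the bound R^{-α} for the mean of the layer is already at most |k|^{-α}.
    · exact Real.rpow_le_rpow_of_nonpos hN hkR.le (by linarith)
  · refine (enorm_torusCoeff_boundaryLayer_le hφ hα1 hγ hM hR 0).trans ?_
    rw [← ENNReal.ofReal_mul hcγ]
    refine ENNReal.ofReal_le_ofReal (mul_le_mul_of_nonneg_right ?_ (by positivity))
    nlinarith

end Minkowski

end ErdosTuran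

/-! ### The two metric discrepancy estimates -/

theorem corollary10 (d : ℕ) (hd : 0 < d) (ε : ℝ) (hε : 0 < ε) :
    (∀ φ : EuclideanSpace ℝ (Fin d) → ℝ, IsProfile φ →
      ∀ᵐ x : UnitAddTorus (Fin d), ∀ η : ℝ, 0 < η → ∃ c : ℝ, 0 < c ∧
        ∀ α β : ℝ, 0 ≤ α → α ≤ ((d : ℝ) + 1) / 2 → 0 ≤ β → β ≤ 1 → η ≤ d + β - α →
        ∀ m : ℕ, 1 < m → ∀ Ω : Set (UnitAddTorus (Fin d)), NullMeasurableSet Ω →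
          ENNReal.ofReal (discrepancy x m Ω) ≤
            ENNReal.ofReal c * fourierConst φ α β Ω *
              ENNReal.ofReal ((m : ℝ) ^ (-β / (d + β - α)) *
                Real.log m ^ (β * (d + 1 + ε) / (d + β - α)))) ∧
    (∀ᵐ x : UnitAddTorus (Fin d), ∃ c : ℝ, 0 < c ∧
      ∀ α : ℝ, 0 ≤ α → α ≤ 1 → ∀ γ : ℝ, ∀ m : ℕ, 1 < m →
      ∀ Ω : Set (UnitAddTorus (Fin d)), NullMeasurableSet Ω →
        minkowskiConst α Ω < ENNReal.ofReal γ →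
          discrepancy x m Ω ≤
            c * γ * (m : ℝ) ^ (-α / d) * Real.log m ^ (α * (d + 1 + ε) / d)) := by
  have hd1 : (1 : ℝ) ≤ d := by exact_mod_cast hd
  constructor
  · intro φ hφ
    filter_upwards [ae_discrepancy_le hd hε] with x hx η hη
    obtain ⟨c, hc, h⟩ := hx η hη
    refine ⟨c, hc, fun α β _ hα _ _ hηθ m hm Ω hΩ => ?_⟩
    have hm0 : (0 : ℝ) < m := by exact_mod_cast one_pos.trans hm
    have hlm : 0 < Real.log m := Real.log_pos (by exact_mod_cast hm)
    have hX : 0 < (m : ℝ) ^ (-β / (d + β - α)) *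
        Real.log m ^ (β * (d + 1 + ε) / (d + β - α)) := by positivity
    set X := (m : ℝ) ^ (-β / (d + β - α)) * Real.log m ^ (β * (d + 1 + ε) / (d + β - α))
    have hcX : 0 < c * X := mul_pos hc hX
    -- The bound holds for each admissible constant; dividing by cX first turns it into a lower
    -- bound for all of them, hence for their infimum.
    have hle : ENNReal.ofReal (discrepancy x m Ω) / ENNReal.ofReal (c * X) ≤
        fourierConst φ α β Ω := by
      refine le_sInf fun F hF => ?_
      rw [ENNReal.div_le_iff (ENNReal.ofReal_pos.2 hcX).ne' ENNReal.ofReal_ne_top]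
      rcases eq_or_ne F ⊤ with rfl | hFt
      · rw [ENNReal.top_mul (ENNReal.ofReal_pos.2 hcX).ne']
        exact le_top
      · rw [← ENNReal.ofReal_toReal hFt, ← ENNReal.ofReal_mul ENNReal.toReal_nonneg]
        refine ENNReal.ofReal_le_ofReal ?_
        have hF' : IsFourierBound φ α β Ω (ENNReal.ofReal F.toReal) := by
          rw [ENNReal.ofReal_toReal hFt]
          exact hF
        have h1 := h φ hφ α β (by linarith) hηθ m hm Ω hΩ _ ENNReal.toReal_nonneg hF'
        linarith
    rw [ENNReal.div_le_iff (ENNReal.ofReal_pos.2 hcX).ne' ENNReal.ofReal_ne_top,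
      ENNReal.ofReal_mul hc.le, ← mul_assoc, mul_comm (fourierConst φ α β Ω)] at hle
    exact hle
  · obtain ⟨φ, hφ⟩ := exists_isProfile d
    filter_upwards [ae_discrepancy_le hd hε] with x hx
    -- With β = α the denominator d + β - α equals d, so η = d serves for every α.
    obtain ⟨c, hc, h⟩ := hx d (one_pos.trans_le hd1)
    have hl := layerConst_nonneg hφ
    refine ⟨c * (1 + layerConst φ), by positivity, fun α hα0 hα1 γ m hm Ω hΩ hM => ?_⟩
    have hγ : 0 ≤ γ := (ENNReal.ofReal_pos.1 (zero_le.trans_lt hM)).le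
    have h1 := h φ hφ α α (hα1.trans hd1) (by linarith) m hm Ω hΩ _ (by positivity)
      (isFourierBound_of_minkowskiConst_le hφ hΩ hα0 hα1 hγ hM.le)
    rw [add_sub_cancel_right] at h1
    refine h1.trans (le_of_eq ?_)
    ring
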